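/- All manifolds are smooth, Hausdorff, finite-dimensional and without boundary. For a function $G:[0,\infty)\to(0,\infty)$ put $I_G(t)=\int_0^t\frac{ds}{\sqrt{G(s)}}+1$. Let $(W,g)$ be a Riemannian manifold, $G\in C^1([0,\infty))$ with values in $(0,\infty)$, and $\gamma\in C^2(W)$ with values in $[0,\infty)$. The pair $(G,\gamma)$ is an *Omori–Yau pair for the Laplacian* on $W$ if - (h1) $\gamma(x)\to+\infty$ as $x\to\infty$ in $W$ (i.e. as $x$ leaves every compact set); - (h2) $G'\ge 0$ and $\int_0^{\infty}\frac{ds}{\sqrt{G(s)}}=+\infty$; - (h3) there is $A>0$ with $|\nabla\gamma|\le A\sqrt{G(\gamma)}\,I_G(\gamma)$ off a compact set; - (h4) there is $B>0$ with $\Delta\gamma\le B\sqrt{G(\gamma)}\,I_G(\gamma)$ off a compact set. It is an *Omori–Yau pair for the Hessian* if, instead of (h4), there is $C>0$ with $\operatorname{Hess}\gamma(v,v)\le C\sqrt{G(\gamma)}\,I_G(\gamma)\,|v|^2$ for all tangent vectors $v$ off a compact set. The *Omori–Yau maximum principle* holds on $W$ if for every $u\in C^2(W)$ with $u^*=\sup_W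 u<\infty$ there are points $x_k\in W$ ($k\ge1$) with $u(x_k)\to u^*$, $|\nabla u|(x_k)<\frac1k$ and $\Delta u(x_k)<\frac1k$. **Lemma 4.6.** Let $M$, $L$, $N$ be Riemannian manifolds with $M$ non-empty, let $\xi\in C^\infty(L)$ be positive, and let $L\times_\xi N$ be $L\times N$ with the warped metric $g_L+\xi^2g_N$. Let $\varphi=(y,z):M\to L\times_\xi N$ be an isometric immersion such that the first entry $y=\pi_L\circ\varphi:M\to L$ is proper, and let $H=\operatorname{tr}\alpha$ be its mean curvature vector, $\alpha$ being the second fundamental form. Let $(G,\gamma)$ be an Omori–Yau pair for the Hessian on $L$ such that $$|\nabla\log\xi|(y')\le\log\Big(\int_0^{\gamma(y')}\frac{ds}{\sqrt{G(s)}}+1\Big)\ \ \text{for all } y'\in L,\qquad |H|(x)\le\log\Big(\int_0^{\gamma(y(x))}\frac{ds}{\sqrt{G(s)}}+1\Big)\ \ \text{for all } x\in M.$$ Then there is a function $\tilde G:[0,\infty)\to(0,\infty)$ such that $(\tilde G,\ \gamma\circ\pi_L\circ\varphi)$ is an Omori–Yau pair for the Laplacian on $M$. In particular, the Omori–Yau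 maximum principle (for the Laplacian) holds on $M$. -/

import Mathlib

open Bundle Set Filter Topology
open scoped Manifold ContDiff

noncomputable section

namespace OmoriYau

theorem isVonNBounded_of_pos {V : Type*} [NormedAddCommGroup V] [NormedSpace ℝ V]
    [FiniteDimensional ℝ V] (B : V →L[ℝ] V →L[ℝ] ℝ) (hB : ∀ v, v ≠ 0 → 0 < B v v) :
    Bornology.IsVonNBounded ℝ {v : V | B v v < 1} := by
  rw [NormedSpace.isVonNBounded_iff]
  have hcont : Continuous fun v : V ↦ B v v := by fun_prop
  rcases (Metric.sphere (0 : V) 1).eq_empty_or_nonempty with he | hne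
  · have h0 : ∀ v : V, v = 0 := by
      intro v
      by_contra hv
      have : (‖v‖⁻¹ • v) ∈ Metric.sphere (0 : V) 1 := by
        simp [norm_smul, norm_ne_zero_iff.mpr hv]
      simp [he] at this
    exact (Bornology.isBounded_singleton (x := (0 : V))).subset fun v _ ↦ h0 v
  · obtain ⟨e, he, hmin⟩ := (isCompact_sphere (0 : V) 1).exists_isMinOn hne hcont.continuousOn
    have hepos : 0 < B e e := hB e (by rintro rfl; simp at he)
    refine (Metric.isBounded_iff_subset_closedBall 0).2 ⟨1 + (B e e)⁻¹, fun v hv ↦ ?_⟩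
    rw [mem_closedBall_zero_iff]
    by_cases hv0 : v = 0
    · subst hv0; rw [norm_zero]; positivity
    have hn : 0 < ‖v‖ := norm_pos_iff.mpr hv0
    have h1 : (‖v‖⁻¹ • v) ∈ Metric.sphere (0 : V) 1 := by
      simp [norm_smul, hn.ne']
    have h2 : B e e ≤ B (‖v‖⁻¹ • v) (‖v‖⁻¹ • v) := hmin h1
    have h3 : B (‖v‖⁻¹ • v) (‖v‖⁻¹ • v) = ‖v‖⁻¹ ^ 2 * B v v := by simp; ring
    have hv' : B v v < 1 := hv
    rw [h3] at h2
    have h4 : B e e * ‖v‖ ^ 2 ≤ 1 := by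
      have : B e e * ‖v‖ ^ 2 ≤ ‖v‖⁻¹ ^ 2 * B v v * ‖v‖ ^ 2 := by gcongr
      have h5 : ‖v‖⁻¹ ^ 2 * B v v * ‖v‖ ^ 2 = B v v := by field_simp
      linarith
    have h6 : ‖v‖ ^ 2 ≤ (B e e)⁻¹ := by
      rw [le_inv_comm₀ (by positivity) hepos, ← one_div, le_div_iff₀ (by positivity)]
      exact h4
    nlinarith [sq_nonneg (‖v‖ - 1)]

/-- Smooth Riemannian metrics on the manifold `M`. -/
abbrev RMetric {E : Type*} [NormedAddCommGroup E] [NormedSpace ℝ E]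
    {H : Type*} [TopologicalSpace H] (I : ModelWithCorners ℝ E H)
    (M : Type*) [TopologicalSpace M] [ChartedSpace H M] [IsManifold I ∞ M] :=
  ContMDiffRiemannianMetric I ∞ E (fun x : M ↦ TangentSpace I x)

section LinAlg

variable {V : Type*} [AddCommGroup V] [Module ℝ V] [FiniteDimensional ℝ V]

theorem exists_orthonormal_basis (B : V →ₗ[ℝ] V →ₗ[ℝ] ℝ) (hs : ∀ v w, B v w = B w v)
    (hB : ∀ v, v ≠ 0 → 0 < B v v) :
    ∃ e : Module.Basis (Fin (Module.finrank ℝ V)) ℝ V,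
      ∀ i j, B (e i) (e j) = if i = j then 1 else 0 := by
  have hsymm : LinearMap.IsSymm B := ⟨fun v w ↦ hs v w⟩
  obtain ⟨b, hb⟩ := LinearMap.BilinForm.exists_orthogonal_basis (B := B) hsymm
  have hpos : ∀ i, 0 < B (b i) (b i) := fun i ↦ hB _ (b.ne_zero i)
  refine ⟨b.isUnitSMul (w := fun i ↦ (√(B (b i) (b i)))⁻¹)
    fun i ↦ (inv_ne_zero (Real.sqrt_pos.2 (hpos i)).ne').isUnit, fun i j ↦ ?_⟩
  simp only [Module.Basis.isUnitSMul_apply, map_smul, LinearMap.smul_apply, smul_eq_mul]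
  split_ifs with h
  · subst h
    have := Real.mul_self_sqrt (hpos i).le
    have := (Real.sqrt_pos.2 (hpos i)).ne'
    field_simp
    nlinarith
  · have : B (b i) (b j) = 0 := hb h
    simp [this]

theorem exists_riesz (B : V →ₗ[ℝ] V →ₗ[ℝ] ℝ) (hB : ∀ v, v ≠ 0 → 0 < B v v) (η : V →ₗ[ℝ] ℝ) :
    ∃ v, ∀ w, B v w = η w := by
  have hinj : Function.Injective B := by
    refine (injective_iff_map_eq_zero B).2 fun v hv ↦ ?_
    by_contra h
    have := hB v h
    simp [hv] at this
  have hsurj : Function.Surjective B :=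
    (LinearMap.injective_iff_surjective_of_finrank_eq_finrank
      (Subspace.dual_finrank_eq (K := ℝ) (V := V)).symm).1 hinj
  obtain ⟨v, hv⟩ := hsurj η
  exact ⟨v, fun w ↦ by rw [hv]⟩

end LinAlg

/-- The pullback `(v, w) ↦ B (A v) (A w)` of a bilinear form. -/
def pullbackForm {V W : Type*} [AddCommGroup V] [Module ℝ V] [TopologicalSpace V]
    [IsTopologicalAddGroup V] [ContinuousSMul ℝ V] [AddCommGroup W] [Module ℝ W]
    [TopologicalSpace W] [IsTopologicalAddGroup W] [ContinuousSMul ℝ W]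
    (B : W →L[ℝ] W →L[ℝ] ℝ) (A : V →L[ℝ] W) : V →L[ℝ] V →L[ℝ] ℝ :=
  (ContinuousLinearMap.precomp ℝ A).comp (B.comp A)

theorem pullbackForm_apply {V W : Type*} [AddCommGroup V] [Module ℝ V] [TopologicalSpace V]
    [IsTopologicalAddGroup V] [ContinuousSMul ℝ V] [AddCommGroup W] [Module ℝ W]
    [TopologicalSpace W] [IsTopologicalAddGroup W] [ContinuousSMul ℝ W]
    (B : W →L[ℝ] W →L[ℝ] ℝ) (A : V →L[ℝ] W) (v w : V) : pullbackForm B A v w = B (A v) (A w) :=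
  rfl

/-- For metric coefficients `G` on `E`, the covector
`z ↦ ((∂_v G)(w, z) + (∂_w G)(v, z) - (∂_z G)(v, w)) / 2` at the point `y`. -/
def lowerChristoffel {E : Type*} [NormedAddCommGroup E] [NormedSpace ℝ E]
    (G : E → E →L[ℝ] E →L[ℝ] ℝ) (y v w : E) : E →L[ℝ] ℝ :=
  (1 / 2 : ℝ) • (fderiv ℝ G y v w + fderiv ℝ G y w v - ((fderiv ℝ G y).flip v).flip w)

section Geometry

variable {E : Type*} [NormedAddCommGroup E] [NormedSpace ℝ E] [FiniteDimensional ℝ E]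
  {H : Type*} [TopologicalSpace H] {I : ModelWithCorners ℝ E H}
  {M : Type*} [TopologicalSpace M] [ChartedSpace H M] [IsManifold I ∞ M]

/-- The inner product of `g` at `x` as a bilinear form over `ℝ`. -/
def metricForm (g : RMetric I M) (x : M) :
    TangentSpace I x →ₗ[ℝ] TangentSpace I x →ₗ[ℝ] ℝ :=
  LinearMap.mk₂ ℝ (fun v w ↦ g.inner x v w) (by simp) (by simp) (by simp) (by simp)

theorem exists_sharp (g : RMetric I M) (x : M) (η : TangentSpace I x →L[ℝ] ℝ) :
    ∃ v : TangentSpace I x, ∀ w, g.inner x v w = η w :=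
  haveI : FiniteDimensional ℝ (TangentSpace I x) := inferInstanceAs (FiniteDimensional ℝ E)
  exists_riesz (metricForm g x) (g.pos x) η

/-- The tangent vector `η♯` dual to the covector `η`: `g (η♯, w) = η w` for all `w`. -/
def sharp (g : RMetric I M) (x : M) (η : TangentSpace I x →L[ℝ] ℝ) : TangentSpace I x :=
  Classical.choose (exists_sharp g x η)

theorem inner_sharp (g : RMetric I M) (x : M) (η : TangentSpace I x →L[ℝ] ℝ)
    (w : TangentSpace I x) : g.inner x (sharp g x η) w = η w :=
  Classical.choose_spec (exists_sharp g x η) w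

/-- The length of a tangent vector. -/
def vnorm (g : RMetric I M) (x : M) (v : TangentSpace I x) : ℝ := √(g.inner x v v)

/-- The gradient of `f` at `x`. -/
def gradient (g : RMetric I M) (f : M → ℝ) (x : M) : TangentSpace I x :=
  sharp g x (mfderiv I 𝓘(ℝ, ℝ) f x)

/-- The coefficients of the metric in the preferred chart `c` at `x`, as a function of the
coordinate `y`: `(v, w) ↦ g (d(c⁻¹)_y v, d(c⁻¹)_y w)`.
All the manifolds considered have no boundary. -/
def metricInChart (g : RMetric I M) (x : M) (y : E) : E →L[ℝ] E →L[ℝ] ℝ :=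
  let A : E →L[ℝ] TangentSpace I ((extChartAt I x).symm y) :=
    mfderiv 𝓘(ℝ, E) I (extChartAt I x).symm y
  pullbackForm (g.inner ((extChartAt I x).symm y)) A

theorem metricInChart_apply (g : RMetric I M) (x : M) (y v w : E) :
    metricInChart g x y v w = g.inner ((extChartAt I x).symm y)
      (mfderiv 𝓘(ℝ, E) I (extChartAt I x).symm y v)
      (mfderiv 𝓘(ℝ, E) I (extChartAt I x).symm y w) :=
  rfl

/-- The Christoffel symbols `Γ(v, w) = Γᵏᵢⱼ vⁱ wʲ ∂ₖ` of the Levi-Civita connection at `x`, in the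
preferred chart at `x`: with `G` the metric coefficients in this chart, `Γ(v, w)` is given by
`g(Γ(v, w), z) = ((∂_v G)(w, z) + (∂_w G)(v, z) - (∂_z G)(v, w)) / 2`. Here `TangentSpace I x` is
by definition the model space `E`, and a vector is identified with its coordinates in the preferred
chart at `x`. -/
def christoffel (g : RMetric I M) (x : M) (v w : TangentSpace I x) : TangentSpace I x :=
  sharp g x (lowerChristoffel (E := E) (metricInChart g x) (extChartAt I x x) v w)

/-- The Hessian `∇df` at `x`, computed in the preferred chart at `x`:
`Hess f (v, w) = ∂_v ∂_w f - df(Γ(v, w))`. -/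
def hessian (g : RMetric I M) (f : M → ℝ) (x : M) (v w : TangentSpace I x) : ℝ :=
  let D : E →L[ℝ] E →L[ℝ] ℝ :=
    fderiv ℝ (fderiv ℝ (f ∘ (extChartAt I x).symm)) (extChartAt I x x)
  let df : TangentSpace I x →L[ℝ] ℝ := mfderiv I 𝓘(ℝ, ℝ) f x
  D v w - df (christoffel g x v w)

theorem exists_orthonormalFrame (g : RMetric I M) (x : M) :
    ∃ e : Module.Basis (Fin (Module.finrank ℝ E)) ℝ (TangentSpace I x),
      ∀ i j, g.inner x (e i) (e j) = if i = j then 1 else 0 :=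
  haveI : FiniteDimensional ℝ (TangentSpace I x) := inferInstanceAs (FiniteDimensional ℝ E)
  exists_orthonormal_basis (metricForm g x) (g.symm x) (g.pos x)

/-- An orthonormal basis of `T_x M`. -/
def orthonormalFrame (g : RMetric I M) (x : M) :
    Module.Basis (Fin (Module.finrank ℝ E)) ℝ (TangentSpace I x) :=
  Classical.choose (exists_orthonormalFrame g x)

theorem inner_orthonormalFrame (g : RMetric I M) (x : M) (i j : Fin (Module.finrank ℝ E)) :
    g.inner x (orthonormalFrame g x i) (orthonormalFrame g x j) = if i = j then 1 else 0 :=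
  Classical.choose_spec (exists_orthonormalFrame g x) i j

/-- The Laplacian: the trace of the Hessian. -/
def laplacian (g : RMetric I M) (f : M → ℝ) (x : M) : ℝ :=
  ∑ i, hessian g f x (orthonormalFrame g x i) (orthonormalFrame g x i)

variable {F : Type*} [NormedAddCommGroup F] [NormedSpace ℝ F] [FiniteDimensional ℝ F]
  {K : Type*} [TopologicalSpace K] {J : ModelWithCorners ℝ F K}
  {Q : Type*} [TopologicalSpace Q] [ChartedSpace K Q] [IsManifold J ∞ Q]

/-- `φ : (M, g) → (Q, h)` is a (smooth) isometric immersion: `φ^* h = g`. -/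
structure IsIsometricImmersion (g : RMetric I M) (h : RMetric J Q) (φ : M → Q) : Prop where
  contMDiff : ContMDiff I J ∞ φ
  isometric : ∀ (x : M) (v w : TangentSpace I x),
    h.inner (φ x) (mfderiv I J φ x v) (mfderiv I J φ x w) = g.inner x v w

/-- The second fundamental form `α(v, w) = ∇̄_v (dφ W) - dφ (∇_v W)` of an isometric immersion
`φ : (M, g) → (Q, h)` (Gauss formula), where `∇` and `∇̄` are the Levi-Civita connections of `g` and
`h` and `W` extends `w`. It is computed in the preferred charts at `x` and `φ x`, for the
extension `W` of `w` with constant coordinates: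
`∇̄_v (dφ W) = ∂_v ∂_w φ + Γ̄(dφ v, dφ w)` and `∇_v W = Γ(v, w)`. -/
def secondFundamentalForm (g : RMetric I M) (h : RMetric J Q) (φ : M → Q) (x : M)
    (v w : TangentSpace I x) : TangentSpace J (φ x) :=
  let D : E →L[ℝ] E →L[ℝ] F :=
    fderiv ℝ (fderiv ℝ (writtenInExtChartAt I J x φ)) (extChartAt I x x)
  let u : TangentSpace J (φ x) := D v w
  u + christoffel h (φ x) (mfderiv I J φ x v) (mfderiv I J φ x w) -
    mfderiv I J φ x (christoffel g x v w)

/-- The mean curvature vector `H = tr α` of an isometric immersion. -/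
def meanCurvature (g : RMetric I M) (h : RMetric J Q) (φ : M → Q) (x : M) :
    TangentSpace J (φ x) :=
  ∑ i, secondFundamentalForm g h φ x (orthonormalFrame g x i) (orthonormalFrame g x i)

end Geometry

section OmoriYauPairs

variable {E : Type*} [NormedAddCommGroup E] [NormedSpace ℝ E] [FiniteDimensional ℝ E]
  {H : Type*} [TopologicalSpace H] {I : ModelWithCorners ℝ E H}
  {W : Type*} [TopologicalSpace W] [ChartedSpace H W] [IsManifold I ∞ W]

/-- `∫₀ᵗ ds / √(G s)`. -/
def recipSqrtIntegral (G : ℝ → ℝ) (t : ℝ) : ℝ := ∫ s in (0 : ℝ)..t, 1 / √(G s)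

/-- The conditions shared by Omori-Yau pairs for the Laplacian and for the Hessian. The function
`G : [0, ∞) → (0, ∞)` is represented by a function on `ℝ`, whose values at negative numbers are
irrelevant. -/
structure IsPrePair (g : RMetric I W) (G : ℝ → ℝ) (γ : W → ℝ) : Prop where
  G_contDiffOn : ContDiffOn ℝ 1 G (Ici 0)
  G_pos : ∀ t, 0 ≤ t → 0 < G t
  G_deriv_nonneg : ∀ t, 0 ≤ t → 0 ≤ derivWithin G (Ici 0) t
  G_integral : Tendsto (recipSqrtIntegral G) atTop atTop
  γ_contMDiff : ContMDiff I 𝓘(ℝ, ℝ) 2 γ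
  γ_nonneg : ∀ x, 0 ≤ γ x
  γ_tendsto : Tendsto γ (cocompact W) atTop
  grad_le : ∃ A > 0, ∃ C : Set W, IsCompact C ∧ ∀ x ∉ C,
    vnorm g x (gradient g γ x) ≤ A * (√(G (γ x)) * (recipSqrtIntegral G (γ x) + 1))

/-- `(G, γ)` is an Omori-Yau pair for the Laplacian on `(W, g)`. -/
structure IsOmoriYauPairLaplacian (g : RMetric I W) (G : ℝ → ℝ) (γ : W → ℝ) : Prop
    extends IsPrePair g G γ where
  laplacian_le : ∃ B > 0, ∃ C : Set W, IsCompact C ∧ ∀ x ∉ C,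
    laplacian g γ x ≤ B * (√(G (γ x)) * (recipSqrtIntegral G (γ x) + 1))

/-- `(G, γ)` is an Omori-Yau pair for the Hessian on `(W, g)`. -/
structure IsOmoriYauPairHessian (g : RMetric I W) (G : ℝ → ℝ) (γ : W → ℝ) : Prop
    extends IsPrePair g G γ where
  hessian_le : ∃ B > 0, ∃ C : Set W, IsCompact C ∧ ∀ x ∉ C, ∀ v : TangentSpace I x,
    hessian g γ x v v ≤
      B * (√(G (γ x)) * (recipSqrtIntegral G (γ x) + 1)) * g.inner x v v

/-- The Omori-Yau maximum principle (for the Laplacian) holds on `(W, g)`. -/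
def OmoriYauPrinciple (g : RMetric I W) : Prop :=
  ∀ u : W → ℝ, ContMDiff I 𝓘(ℝ, ℝ) 2 u → BddAbove (range u) →
    ∃ x : ℕ → W, Tendsto (fun k ↦ u (x k)) atTop (𝓝 (⨆ y, u y)) ∧
      ∀ k : ℕ, 1 ≤ k → vnorm g (x k) (gradient g u (x k)) < 1 / (k : ℝ) ∧
        laplacian g u (x k) < 1 / (k : ℝ)

end OmoriYauPairs

section Smooth
variable {E : Type*} [NormedAddCommGroup E] [NormedSpace ℝ E] [FiniteDimensional ℝ E]
  {H : Type*} [TopologicalSpace H] {I : ModelWithCorners ℝ E H}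
  {M : Type*} [TopologicalSpace M] [ChartedSpace H M] [IsManifold I ∞ M]

theorem contMDiffAt_bilin_of_apply
    (s : ∀ x : M, TangentSpace I x →L[ℝ] TangentSpace I x →L[ℝ] ℝ) (x₀ : M)
    (h : ∀ v w : E, ContMDiffAt I 𝓘(ℝ, ℝ) ∞ (fun x ↦ s x
      ((trivializationAt E (TangentSpace I : M → Type _) x₀).symmL ℝ x v)
      ((trivializationAt E (TangentSpace I : M → Type _) x₀).symmL ℝ x w)) x₀) :
    ContMDiffAt I (I.prod 𝓘(ℝ, E →L[ℝ] E →L[ℝ] ℝ)) ∞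
      (fun x ↦ TotalSpace.mk' (E →L[ℝ] E →L[ℝ] ℝ)
        (E := fun x : M ↦ TangentSpace I x →L[ℝ] TangentSpace I x →L[ℝ] ℝ) x (s x)) x₀ := by
  rw [contMDiffAt_hom_bundle]
  refine ⟨contMDiffAt_id, ?_⟩
  let b := Module.finBasis ℝ E
  let c : Fin (Module.finrank ℝ E) → (E →L[ℝ] ℝ) := fun i ↦ (b.coord i).toContinuousLinearMap
  have key : ContMDiffAt I 𝓘(ℝ, E →L[ℝ] E →L[ℝ] ℝ) ∞ (fun x ↦ ∑ i, ∑ j,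
      (s x ((trivializationAt E (TangentSpace I : M → Type _) x₀).symmL ℝ x (b i))
        ((trivializationAt E (TangentSpace I : M → Type _) x₀).symmL ℝ x (b j))) •
        ((c i).smulRight (c j) : E →L[ℝ] E →L[ℝ] ℝ)) x₀ := by
    refine ContMDiffAt.sum fun i _ ↦ ContMDiffAt.sum fun j _ ↦ ?_
    exact (h (b i) (b j)).smul contMDiffAt_const
  refine key.congr_of_eventuallyEq ?_
  filter_upwards [(trivializationAt E (TangentSpace I : M → Type _) x₀).open_baseSet.mem_nhds
    (mem_baseSet_trivializationAt E (TangentSpace I : M → Type _) x₀)] with x hx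
  ext v w
  rw [inCoordinates_apply_eq₂ hx hx (Set.mem_univ _)]
  have hv : ∀ u : E, (trivializationAt E (TangentSpace I : M → Type _) x₀).symm x u =
      (trivializationAt E (TangentSpace I : M → Type _) x₀).symmL ℝ x u := fun u ↦ (Trivialization.symmL_apply _ hx u).symm
  simp only [hv]
  have hexp : ∀ u : E, (trivializationAt E (TangentSpace I : M → Type _) x₀).symmL ℝ x u =
      ∑ i, b.repr u i •
        (trivializationAt E (TangentSpace I : M → Type _) x₀).symmL ℝ x (b i) := by
    intro u
    conv_lhs => rw [← b.sum_repr u]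
    simp only [map_sum, map_smul]
  simp only [Trivial.fiberBundle_trivializationAt', Trivial.linearMapAt_trivialization,
    LinearMap.id_coe, id_eq]
  rw [hexp v, hexp w]
  simp only [map_sum, map_smul, sum_apply, smul_apply]
  simp [c, Finset.mul_sum]
  rw [Finset.sum_comm]
  refine Finset.sum_congr rfl fun i _ ↦ Finset.sum_congr rfl fun j _ ↦ ?_
  ring

end Smooth


section Warped

variable {E : Type*} [NormedAddCommGroup E] [NormedSpace ℝ E]
  {H : Type*} [TopologicalSpace H] {I : ModelWithCorners ℝ E H}
  {L : Type*} [TopologicalSpace L] [ChartedSpace H L] [IsManifold I ∞ L]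
  {F : Type*} [NormedAddCommGroup F] [NormedSpace ℝ F]
  {K : Type*} [TopologicalSpace K] {J : ModelWithCorners ℝ F K}
  {N : Type*} [TopologicalSpace N] [ChartedSpace K N] [IsManifold J ∞ N]

/-- The bilinear form `π_L^* g_L + (ξ ∘ π_L)² π_N^* g_N` on the tangent spaces of `L × N`. -/
def warpedInner (gL : RMetric I L) (gN : RMetric J N) (ξ : L → ℝ) (p : L × N) :
    TangentSpace (I.prod J) p →L[ℝ] TangentSpace (I.prod J) p →L[ℝ] ℝ :=
  pullbackForm (gL.inner p.1) (mfderiv (I.prod J) I Prod.fst p) +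
    (ξ p.1) ^ 2 • pullbackForm (gN.inner p.2) (mfderiv (I.prod J) J Prod.snd p)

theorem warpedInner_apply (gL : RMetric I L) (gN : RMetric J N) (ξ : L → ℝ) (p : L × N)
    (v w : TangentSpace (I.prod J) p) : warpedInner gL gN ξ p v w =
      gL.inner p.1 (mfderiv (I.prod J) I Prod.fst p v) (mfderiv (I.prod J) I Prod.fst p w) +
      (ξ p.1) ^ 2 * gN.inner p.2 (mfderiv (I.prod J) J Prod.snd p v)
        (mfderiv (I.prod J) J Prod.snd p w) := rfl

theorem warpedInner_pos (gL : RMetric I L) (gN : RMetric J N) (ξ : L → ℝ) (hpos : ∀ y, 0 < ξ y)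
    (p : L × N) (v : TangentSpace (I.prod J) p) (hv : v ≠ 0) : 0 < warpedInner gL gN ξ p v v := by
  have nnL : ∀ u, 0 ≤ gL.inner p.1 u u := fun u ↦ by
    by_cases h : u = 0
    · simp [h]
    · exact (gL.pos _ _ h).le
  have nnN : ∀ u, 0 ≤ gN.inner p.2 u u := fun u ↦ by
    by_cases h : u = 0
    · simp [h]
    · exact (gN.pos _ _ h).le
  have hξ : 0 < (ξ p.1) ^ 2 := pow_pos (hpos _) 2
  rw [warpedInner_apply, mfderiv_fst, mfderiv_snd]
  by_cases h1 : (v : E × F).1 = 0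
  · have h2 : (v : E × F).2 ≠ 0 := fun h2 ↦ hv (Prod.ext h1 h2)
    exact add_pos_of_nonneg_of_pos (nnL _) (mul_pos hξ (gN.pos p.2 _ h2))
  · exact add_pos_of_pos_of_nonneg (gL.pos p.1 _ h1) (mul_nonneg hξ.le (nnN _))

theorem contMDiffAt_pullback {E' : Type*} [NormedAddCommGroup E'] [NormedSpace ℝ E']
    {H' : Type*} [TopologicalSpace H'] {I' : ModelWithCorners ℝ E' H'}
    {P : Type*} [TopologicalSpace P] [ChartedSpace H' P] [IsManifold I' ∞ P]
    (g : RMetric I L) (f : P → L) (hf : ContMDiff I' I ∞ f) (p₀ : P)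
    (V W : ∀ p, TangentSpace I' p)
    (hV : ContMDiffAt I' I'.tangent ∞ (fun p ↦ (⟨p, V p⟩ : TangentBundle I' P)) p₀)
    (hW : ContMDiffAt I' I'.tangent ∞ (fun p ↦ (⟨p, W p⟩ : TangentBundle I' P)) p₀) :
    ContMDiffAt I' 𝓘(ℝ, ℝ) ∞
      (fun p ↦ g.inner (f p) (mfderiv I' I f p (V p)) (mfderiv I' I f p (W p))) p₀ := by
  have hV' := ((hf.contMDiff_tangentMap (m := ∞) (by simp)) _).comp p₀ hV
  have hW' := ((hf.contMDiff_tangentMap (m := ∞) (by simp)) _).comp p₀ hW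
  have hg := (g.contMDiff (f p₀)).comp p₀ (hf p₀)
  have := ContMDiffAt.clm_bundle_apply₂ (F₁ := E) (F₂ := E) (F₃ := ℝ)
    (E₁ := fun x : L ↦ TangentSpace I x) (E₂ := fun x : L ↦ TangentSpace I x)
    (E₃ := Bundle.Trivial L ℝ) (b := f)
    (ψ := fun p ↦ g.inner (f p)) (v := fun p ↦ mfderiv I' I f p (V p))
    (w := fun p ↦ mfderiv I' I f p (W p)) hg hV' hW'
  rw [contMDiffAt_totalSpace] at this
  exact this.2

/-- The metric `g_L + ξ² g_N` of the warped product `L ×_ξ N`. -/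
def warpedMetric [FiniteDimensional ℝ E] [FiniteDimensional ℝ F] (gL : RMetric I L) (gN : RMetric J N) (ξ : L → ℝ)
    (hξ : ContMDiff I 𝓘(ℝ, ℝ) ∞ ξ) (hpos : ∀ y, 0 < ξ y) : RMetric (I.prod J) (L × N) where
  inner := warpedInner gL gN ξ
  symm p v w := by
    simp only [warpedInner_apply]
    rw [gL.symm, gN.symm]
  pos := warpedInner_pos gL gN ξ hpos
  isVonNBounded p := isVonNBounded_of_pos (V := E × F) (warpedInner gL gN ξ p)
    (warpedInner_pos gL gN ξ hpos p)
  contMDiff p₀ := by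
    refine contMDiffAt_bilin_of_apply _ _ fun v w ↦ ?_
    have hsec : ∀ u : E × F, ContMDiffAt (I.prod J) (I.prod J).tangent ∞
        (fun p ↦ (⟨p, (trivializationAt (E × F)
          (TangentSpace (I.prod J) : L × N → Type _) p₀).symmL ℝ p u⟩ :
            TangentBundle (I.prod J) (L × N))) p₀ := by
      intro u
      set e := trivializationAt (E × F) (TangentSpace (I.prod J) : L × N → Type _) p₀ with he
      have hp₀ : p₀ ∈ e.baseSet := mem_baseSet_trivializationAt _ _ p₀
      refine (e.contMDiffAt_section_iff (IB := I.prod J) hp₀).2 ?_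
      refine (contMDiffAt_const (c := u)).congr_of_eventuallyEq ?_
      filter_upwards [e.open_baseSet.mem_nhds hp₀] with p hp
      rw [e.symmL_apply hp, e.mk_symm hp, e.apply_symm_apply (e.mk_mem_target.2 hp)]
    simp only [warpedInner_apply]
    refine (contMDiffAt_pullback gL Prod.fst contMDiff_fst p₀ _ _ (hsec v) (hsec w)).add ?_
    refine (((hξ.comp contMDiff_fst).contMDiffAt).pow 2).mul ?_
    exact contMDiffAt_pullback gN Prod.snd contMDiff_snd p₀ _ _ (hsec v) (hsec w)

end Warped

end OmoriYau


end

/-!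
Put `I(t) = ∫₀ᵗ ds / √G + 1` and `f = γ ∘ π_L ∘ φ`. By the Gauss formula (`hessian_comp`), the
Laplacian of `f` on `M` is the trace over `TM` of the Hessian of `γ ∘ π_L` on the warped product,
plus `⟨∇(γ ∘ π_L), H⟩`. The Hessian of the lift is that of `γ` on the vectors of `L`, and
`⟨∇ log ξ, ∇ γ⟩` times the metric on the vectors of `N` (`hessian_warpedMetric_comp_fst`). The
assumptions on `∇ γ`, `Hess γ`, `∇ log ξ` and `H` thus bound the Laplacian of `f` by a multiple of
`√G I (log I + 1)` at `f`, off the preimage of a compact subset of `L`, which is compact by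
properness. The function `G I²` turns this into an Omori-Yau pair: `1 / √(G I²) = (log I)'`, so the
function that plays the role of `I` for `G I²` is `log I + 1`, and it still tends to infinity
(`recipSqrtIntegral_logScale`).

For the maximum principle of a pair `(G, γ)`, let `u` be bounded above. If the supremum is
attained, a maximum point will do. Otherwise a maximum point `x` of `u - ε log I(γ)`, with `ε` small,
lies off the exceptional compact set. As `log I` is concave (`log_recipSqrtIntegral_le`),
`u - c γ` is also maximal at `x` for `c = ε / (√G I)(γ x)`; hence `∇ u = c ∇ γ` and
`Δ u ≤ c Δ γ` at `x`, and these are small by the definition of a pair. Replacing `log I(γ)` by its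
tangent line avoids second derivatives of `I`.
-/

noncomputable section

namespace OmoriYau

/-! ### The integral of `1 / √G` -/

section RecipSqrtIntegral

variable {G : ℝ → ℝ}

/-- `recipSqrtIntegral G` agrees on `[0, ∞)` with a function that is `C¹` on all of `ℝ`, namely the
integral of the extension of `1 / √G` that is constant on the negative axis. It gives two-sided
derivatives also at `0`, whatever the values of `G` at negative numbers. -/
theorem exists_contDiff_eq_recipSqrtIntegral (hG : ContDiffOn ℝ 1 G (Ici 0))
    (hpos : ∀ t, 0 ≤ t → 0 < G t) :
    ∃ J : ℝ → ℝ, ContDiff ℝ 1 J ∧ (∀ t, 0 ≤ t → recipSqrtIntegral G t = J t) ∧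
      ∀ t, 0 ≤ t → HasDerivAt J (1 / √(G t)) t := by
  let F : ℝ → ℝ := fun s ↦ 1 / √(G (max s 0))
  have hGc : Continuous fun s ↦ G (max s 0) :=
    hG.continuousOn.comp_continuous (by fun_prop) fun s ↦ le_max_right s 0
  have hF : Continuous F := continuous_const.div (Real.continuous_sqrt.comp hGc) fun s ↦
    (Real.sqrt_pos.2 (hpos _ (le_max_right s 0))).ne'
  have hd : ∀ t, HasDerivAt (fun t ↦ ∫ s in (0 : ℝ)..t, F s) (F t) t := fun t ↦
    intervalIntegral.integral_hasDerivAt_right (hF.intervalIntegrable _ _)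
      (hF.stronglyMeasurableAtFilter _ _) hF.continuousAt
  refine ⟨fun t ↦ ∫ s in (0 : ℝ)..t, F s, ?_, fun t ht ↦ ?_, fun t ht ↦ ?_⟩
  · rw [contDiff_one_iff_deriv]
    refine ⟨fun t ↦ (hd t).differentiableAt, ?_⟩
    rw [funext fun t ↦ (hd t).deriv]
    exact hF
  · refine intervalIntegral.integral_congr fun s hs ↦ ?_
    rw [uIcc_of_le ht] at hs
    simp [F, max_eq_left hs.1]
  · simpa [F, max_eq_left ht] using hd t

theorem recipSqrtIntegral_nonneg {t : ℝ} (ht : 0 ≤ t) : 0 ≤ recipSqrtIntegral G t :=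
  intervalIntegral.integral_nonneg ht fun s _ ↦ by positivity

/-- For `I = ∫₀ ds / √G + 1`, the function `G I²`. The integral belonging to it is `log I`. -/
def logScale (G : ℝ → ℝ) (t : ℝ) : ℝ := G t * (recipSqrtIntegral G t + 1) ^ 2

theorem sqrt_logScale {t : ℝ} (ht : 0 ≤ t) :
    √(logScale G t) = √(G t) * (recipSqrtIntegral G t + 1) := by
  have := recipSqrtIntegral_nonneg (G := G) ht
  rw [logScale, Real.sqrt_mul' _ (sq_nonneg _), Real.sqrt_sq (by linarith)]

theorem logScale_pos (hpos : ∀ t, 0 ≤ t → 0 < G t) {t : ℝ} (ht : 0 ≤ t) :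
    0 < logScale G t := by
  have := recipSqrtIntegral_nonneg (G := G) ht
  exact mul_pos (hpos t ht) (by positivity)

/-- `1 / √(G I²) = I' / I`, as `I' = 1 / √G`. -/
theorem recipSqrtIntegral_logScale (hG : ContDiffOn ℝ 1 G (Ici 0))
    (hpos : ∀ t, 0 ≤ t → 0 < G t) {t : ℝ} (ht : 0 ≤ t) :
    recipSqrtIntegral (logScale G) t = Real.log (recipSqrtIntegral G t + 1) := by
  obtain ⟨J, hJ, hJeq, hJd⟩ := exists_contDiff_eq_recipSqrtIntegral hG hpos
  have hJ0 : ∀ s, 0 ≤ s → 0 ≤ J s := fun s hs ↦ hJeq s hs ▸ recipSqrtIntegral_nonneg hs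
  have hd : ∀ s ∈ uIcc 0 t, HasDerivAt (fun s ↦ Real.log (J s + 1)) (1 / √(logScale G s)) s := by
    intro s hs
    rw [uIcc_of_le ht] at hs
    have h0 : 0 < J s + 1 := by linarith [hJ0 s hs.1]
    convert! ((hJd s hs.1).add_const 1).log h0.ne' using 1
    rw [sqrt_logScale hs.1, hJeq s hs.1, div_div]
  have hcont : ContinuousOn (fun s ↦ 1 / √(logScale G s)) (uIcc 0 t) := by
    have h : ContinuousOn (fun s ↦ 1 / √(G s) / (J s + 1)) (uIcc 0 t) := by
      rw [uIcc_of_le ht]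
      refine (continuousOn_const.div ((hG.continuousOn.mono Icc_subset_Ici_self).sqrt)
        fun s hs ↦ (Real.sqrt_pos.2 (hpos s hs.1)).ne').div
        (hJ.continuous.continuousOn.add continuousOn_const) fun s hs ↦ ?_
      linarith [hJ0 s hs.1]
    refine h.congr fun s hs ↦ ?_
    rw [uIcc_of_le ht] at hs
    simp only
    rw [sqrt_logScale hs.1, hJeq s hs.1, div_div]
  rw [recipSqrtIntegral, intervalIntegral.integral_eq_sub_of_hasDerivAt hd
    hcont.intervalIntegrable, ← hJeq t ht, ← hJeq 0 le_rfl]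
  simp [recipSqrtIntegral]

theorem contDiffOn_logScale (hG : ContDiffOn ℝ 1 G (Ici 0)) (hpos : ∀ t, 0 ≤ t → 0 < G t) :
    ContDiffOn ℝ 1 (logScale G) (Ici 0) := by
  obtain ⟨J, hJ, hJeq, -⟩ := exists_contDiff_eq_recipSqrtIntegral hG hpos
  refine (hG.mul ((hJ.add contDiff_const).pow 2).contDiffOn).congr (f₁ := logScale G)
    (f := fun t ↦ G t * (J t + 1) ^ 2) fun t ht ↦ ?_
  rw [logScale, hJeq t ht]

theorem derivWithin_logScale_nonneg (hG : ContDiffOn ℝ 1 G (Ici 0))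
    (hpos : ∀ t, 0 ≤ t → 0 < G t) (hderiv : ∀ t, 0 ≤ t → 0 ≤ derivWithin G (Ici 0) t)
    {t : ℝ} (ht : 0 ≤ t) : 0 ≤ derivWithin (logScale G) (Ici 0) t := by
  obtain ⟨J, hJ, hJeq, hJd⟩ := exists_contDiff_eq_recipSqrtIntegral hG hpos
  have hJ0 : 0 ≤ J t := hJeq t ht ▸ recipSqrtIntegral_nonneg ht
  have h1 : HasDerivWithinAt G (derivWithin G (Ici 0) t) (Ici 0) t :=
    (hG.differentiableOn one_ne_zero t ht).hasDerivWithinAt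
  have h2 := h1.mul ((((hJd t ht).add_const 1).pow 2).hasDerivWithinAt)
  have h3 : HasDerivWithinAt (logScale G) _ (Ici 0) t :=
    h2.congr (fun s hs ↦ by simp [logScale, hJeq s hs]) (by simp [logScale, hJeq t ht])
  rw [h3.derivWithin (uniqueDiffOn_Ici 0 t ht)]
  have := hderiv t ht
  have := hpos t ht
  simp only [Pi.pow_apply]
  positivity

/-- The reciprocal `1 / √G` is nonincreasing, so `I = ∫₀ ds / √G + 1` is concave and so is `log I`:
its graph lies below its tangent lines. -/
theorem log_recipSqrtIntegral_le (hG : ContDiffOn ℝ 1 G (Ici 0))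
    (hpos : ∀ t, 0 ≤ t → 0 < G t) (hderiv : ∀ t, 0 ≤ t → 0 ≤ derivWithin G (Ici 0) t)
    {s t : ℝ} (hs : 0 ≤ s) (ht : 0 ≤ t) :
    Real.log (recipSqrtIntegral G s + 1) ≤ Real.log (recipSqrtIntegral G t + 1) +
      (√(G t) * (recipSqrtIntegral G t + 1))⁻¹ * (s - t) := by
  have hmono : MonotoneOn G (Ici 0) := by
    refine monotoneOn_of_deriv_nonneg (convex_Ici 0) hG.continuousOn
      ((hG.differentiableOn one_ne_zero).mono interior_subset) fun x hx ↦ ?_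
    rw [interior_Ici] at hx
    rw [← derivWithin_of_mem_nhds (Ici_mem_nhds hx)]
    exact hderiv x (le_of_lt hx)
  have hanti : ∀ a b, 0 ≤ a → a ≤ b → 1 / √(G b) ≤ 1 / √(G a) := fun a b ha hab ↦
    one_div_le_one_div_of_le (Real.sqrt_pos.2 (hpos a ha))
      (Real.sqrt_le_sqrt (hmono ha (ha.trans hab) hab))
  have hint : ∀ a b, 0 ≤ a → 0 ≤ b →
      IntervalIntegrable (fun x ↦ 1 / √(G x)) MeasureTheory.volume a b := fun a b ha hb ↦ by
    refine ContinuousOn.intervalIntegrable ?_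
    have hsub : uIcc a b ⊆ Ici 0 := fun x hx ↦ (le_min ha hb).trans hx.1
    exact continuousOn_const.div ((hG.continuousOn.mono hsub).sqrt)
      fun x hx ↦ (Real.sqrt_pos.2 (hpos x (hsub hx))).ne'
  have hdiff : recipSqrtIntegral G s - recipSqrtIntegral G t ≤ (1 / √(G t)) * (s - t) := by
    rw [recipSqrtIntegral, recipSqrtIntegral,
      intervalIntegral.integral_interval_sub_left (hint 0 s le_rfl hs) (hint 0 t le_rfl ht)]
    rcases le_total t s with h | h
    · have := intervalIntegral.integral_mono_on h (hint t s ht hs)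
        (intervalIntegrable_const (c := 1 / √(G t))) fun x hx ↦ hanti t x ht hx.1
      rw [intervalIntegral.integral_const, smul_eq_mul] at this
      linarith
    · have := intervalIntegral.integral_mono_on h (intervalIntegrable_const (c := 1 / √(G t)))
        (hint s t hs ht) fun x hx ↦ hanti x t (hs.trans hx.1) hx.2
      rw [intervalIntegral.integral_const, smul_eq_mul] at this
      rw [intervalIntegral.integral_symm]
      linarith
  have hs0 : 0 < recipSqrtIntegral G s + 1 := by linarith [recipSqrtIntegral_nonneg (G := G) hs]
  have ht0 : 0 < recipSqrtIntegral G t + 1 := by linarith [recipSqrtIntegral_nonneg (G := G) ht]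
  have hlog := Real.log_le_sub_one_of_pos (div_pos hs0 ht0)
  rw [Real.log_div hs0.ne' ht0.ne'] at hlog
  have h1 : (recipSqrtIntegral G s + 1) / (recipSqrtIntegral G t + 1) - 1 =
      (recipSqrtIntegral G s - recipSqrtIntegral G t) / (recipSqrtIntegral G t + 1) := by
    field_simp
    ring
  have h2 : (recipSqrtIntegral G s - recipSqrtIntegral G t) / (recipSqrtIntegral G t + 1) ≤
      (1 / √(G t)) * (s - t) / (recipSqrtIntegral G t + 1) := by gcongr
  have h3 : (1 / √(G t)) * (s - t) / (recipSqrtIntegral G t + 1) =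
      (√(G t) * (recipSqrtIntegral G t + 1))⁻¹ * (s - t) := by
    rw [mul_inv]
    ring
  linarith

theorem tendsto_recipSqrtIntegral_logScale (hG : ContDiffOn ℝ 1 G (Ici 0))
    (hpos : ∀ t, 0 ≤ t → 0 < G t) (h : Tendsto (recipSqrtIntegral G) atTop atTop) :
    Tendsto (recipSqrtIntegral (logScale G)) atTop atTop := by
  refine (Real.tendsto_log_atTop.comp (tendsto_atTop_add_const_right _ 1 h)).congr' ?_
  filter_upwards [eventually_ge_atTop 0] with t ht
  exact (recipSqrtIntegral_logScale hG hpos ht).symm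

end RecipSqrtIntegral

/-! ### Second derivatives and charts -/

section FDeriv

variable {E F : Type*} [NormedAddCommGroup E] [NormedSpace ℝ E]
  [NormedAddCommGroup F] [NormedSpace ℝ F]

theorem fderiv_fderiv_comp_apply {p : F → ℝ} {Φ : E → F} {a : E} (hp : ContDiffAt ℝ 2 p (Φ a))
    (hΦ : ContDiffAt ℝ 2 Φ a) (v w : E) :
    fderiv ℝ (fderiv ℝ (p ∘ Φ)) a v w =
      fderiv ℝ (fderiv ℝ p) (Φ a) (fderiv ℝ Φ a v) (fderiv ℝ Φ a w) +
        fderiv ℝ p (Φ a) (fderiv ℝ (fderiv ℝ Φ) a v w) := by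
  have hev : fderiv ℝ (p ∘ Φ) =ᶠ[𝓝 a] fun y ↦ (fderiv ℝ p (Φ y)).comp (fderiv ℝ Φ y) := by
    have h1 := hΦ.continuousAt.eventually (hp.eventually (by simp))
    have h2 := hΦ.eventually (by simp)
    filter_upwards [h1, h2] with y hy1 hy2
    exact fderiv_comp y (hy1.differentiableAt two_ne_zero) (hy2.differentiableAt two_ne_zero)
  have hdp : DifferentiableAt ℝ (fderiv ℝ p) (Φ a) :=
    (hp.fderiv_right (m := 1) le_rfl).differentiableAt one_ne_zero
  have hdΦ : DifferentiableAt ℝ (fderiv ℝ Φ) a :=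
    (hΦ.fderiv_right (m := 1) le_rfl).differentiableAt one_ne_zero
  have h3 := hdp.hasFDerivAt.comp a (hΦ.differentiableAt two_ne_zero).hasFDerivAt
  have h4 := h3.clm_comp hdΦ.hasFDerivAt
  rw [hev.fderiv_eq]
  have h5 : HasFDerivAt (fun y ↦ (fderiv ℝ p (Φ y)).comp (fderiv ℝ Φ y)) _ a := h4
  rw [h5.fderiv]
  simp [add_comm]

/-- If `D²f(v, v)` were positive, then `f` would have a local minimum at `a` along the line `a + ℝ v`.
Being also a local maximum, it would make `f` constant near `a` on that line. -/
theorem fderiv_fderiv_apply_le_of_isLocalMax {f : E → ℝ} {a : E} (hf : ContDiffAt ℝ 2 f a)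
    (hmax : IsLocalMax f a) (v : E) : fderiv ℝ (fderiv ℝ f) a v v ≤ 0 := by
  by_contra! hlt
  let c : ℝ → E := fun t ↦ a + t • v
  have hc : ∀ t, HasDerivAt c v t := fun t ↦ by
    simpa [c] using ((hasDerivAt_id t).smul_const v).const_add a
  have hc0 : c 0 = a := by simp [c]
  have hcc : ContinuousAt c 0 := (hc 0).continuousAt
  have hev : deriv (f ∘ c) =ᶠ[𝓝 0] fun t ↦ fderiv ℝ f (c t) v := by
    have h1 : ∀ᶠ y in 𝓝 (c 0), ContDiffAt ℝ 2 f y := hc0 ▸ hf.eventually (by simp)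
    filter_upwards [hcc.eventually h1] with t ht
    exact ((ht.differentiableAt two_ne_zero).hasFDerivAt.comp_hasDerivAt t (hc t)).deriv
  have hdf : DifferentiableAt ℝ (fderiv ℝ f) (c 0) :=
    hc0 ▸ (hf.fderiv_right (m := 1) le_rfl).differentiableAt one_ne_zero
  have hdd : deriv (deriv (f ∘ c)) 0 = fderiv ℝ (fderiv ℝ f) a v v := by
    rw [hev.deriv_eq]
    have h := (hdf.hasFDerivAt.comp_hasDerivAt 0 (hc 0)).clm_apply (hasDerivAt_const 0 v)
    simpa [hc0] using h.deriv
  have hmax' : IsLocalMax (f ∘ c) 0 := by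
    have h : IsLocalMax f (c 0) := hc0 ▸ hmax
    exact h.comp_continuous hcc
  have hmin : IsLocalMin (f ∘ c) 0 := by
    refine isLocalMin_of_deriv_deriv_pos (hdd ▸ hlt) hmax'.deriv_eq_zero ?_
    exact ContinuousAt.comp (hc0 ▸ hf.continuousAt) hcc
  have hconst : f ∘ c =ᶠ[𝓝 0] fun _ ↦ f (c 0) := by
    filter_upwards [hmax', hmin] with t h1 h2
    exact le_antisymm h1 h2
  have : deriv (deriv (f ∘ c)) 0 = 0 := by
    rw [hconst.deriv.deriv_eq]
    simp
  linarith

end FDeriv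

section Charts

variable {E : Type*} [NormedAddCommGroup E] [NormedSpace ℝ E]
  {H : Type*} [TopologicalSpace H] {I : ModelWithCorners ℝ E H}
  {M : Type*} [TopologicalSpace M] [ChartedSpace H M]
  {F : Type*} [NormedAddCommGroup F] [NormedSpace ℝ F]
  {K : Type*} [TopologicalSpace K] {J : ModelWithCorners ℝ F K}
  {Q : Type*} [TopologicalSpace Q] [ChartedSpace K Q]

/-- The differential of a function as a covector, with values in `ℝ` rather than in the tangent
spaces of `ℝ`. -/
def differential (I : ModelWithCorners ℝ E H) (f : M → ℝ) (x : M) : TangentSpace I x →L[ℝ] ℝ :=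
  mfderiv I 𝓘(ℝ, ℝ) f x

theorem differential_comp {φ : M → Q} {P : Q → ℝ} {x : M}
    (hP : MDifferentiableAt J 𝓘(ℝ, ℝ) P (φ x)) (hφ : MDifferentiableAt I J φ x)
    (v : TangentSpace I x) :
    differential I (P ∘ φ) x v = differential J P (φ x) (mfderiv I J φ x v) :=
  DFunLike.congr_fun (mfderiv_comp x hP hφ) v

theorem differential_log {ξ : M → ℝ} (hξ : ContMDiff I 𝓘(ℝ, ℝ) ∞ ξ) (hpos : ∀ y, 0 < ξ y)
    (y : M) (v : TangentSpace I y) :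
    differential I (fun z ↦ Real.log (ξ z)) y v = (ξ y)⁻¹ * differential I ξ y v := by
  have hm : MDifferentiableAt I 𝓘(ℝ, ℝ) ξ y := (hξ y).mdifferentiableAt (by simp)
  have hl : MDifferentiableAt 𝓘(ℝ, ℝ) 𝓘(ℝ, ℝ) Real.log (ξ y) :=
    mdifferentiableAt_iff_differentiableAt.2 (Real.differentiableAt_log (hpos y).ne')
  have h := differential_comp hl hm v
  have h2 : differential 𝓘(ℝ, ℝ) Real.log (ξ y) = fderiv ℝ Real.log (ξ y) :=
    mfderiv_eq_fderiv
  rw [h2] at h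
  have h3 : ∀ c : ℝ, fderiv ℝ Real.log (ξ y) c = (ξ y)⁻¹ * c := fun c ↦ by
    rw [(Real.hasDerivAt_log (hpos y).ne').hasFDerivAt.fderiv]
    simp [mul_comm]
  exact h.trans (h3 _)

theorem inner_gradient [IsManifold I ∞ M] [FiniteDimensional ℝ E] (g : RMetric I M)
    (f : M → ℝ) (x : M) (v : TangentSpace I x) :
    g.inner x (gradient g f x) v = differential I f x v :=
  inner_sharp g x _ v

/-- The definition of the Hessian, with `df` as a covector with values in `ℝ`. -/
theorem hessian_eq [IsManifold I ∞ M] [FiniteDimensional ℝ E] (g : RMetric I M)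
    (f : M → ℝ) (x : M) (v w : TangentSpace I x) :
    hessian g f x v w =
      fderiv ℝ (fderiv ℝ (f ∘ (extChartAt I x).symm)) (extChartAt I x x) v w -
        differential I f x (christoffel g x v w) :=
  rfl

variable [I.Boundaryless]

theorem contDiffAt_writtenInExtChartAt {n : ℕ∞ω} {f : M → Q} {x : M}
    (hf : ContMDiffAt I J n f x) :
    ContDiffAt ℝ n (writtenInExtChartAt I J x f) (extChartAt I x x) := by
  have := (contMDiffAt_iff.1 hf).2
  rwa [I.range_eq_univ, contDiffWithinAt_univ] at this

theorem mfderiv_apply_eq_fderiv {f : M → Q} {x : M} (hf : MDifferentiableAt I J f x) (v : E) :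
    mfderiv I J f x v = fderiv ℝ (writtenInExtChartAt I J x f) (extChartAt I x x) v := by
  have h := hf.mfderiv
  rw [I.range_eq_univ, fderivWithin_univ] at h
  exact DFunLike.congr_fun h v

theorem contDiffAt_comp_extChartAt_symm {f : M → ℝ} {x : M}
    (hf : ContMDiffAt I 𝓘(ℝ, ℝ) 2 f x) :
    ContDiffAt ℝ 2 (f ∘ (extChartAt I x).symm) (extChartAt I x x) :=
  contDiffAt_writtenInExtChartAt hf

theorem differential_eq_fderiv {f : M → ℝ} {x : M} (hf : MDifferentiableAt I 𝓘(ℝ, ℝ) f x) :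
    differential I f x = fderiv ℝ (f ∘ (extChartAt I x).symm) (extChartAt I x x) :=
  ContinuousLinearMap.ext fun v ↦ mfderiv_apply_eq_fderiv hf v

variable [IsManifold I ∞ M] [J.Boundaryless] [IsManifold J ∞ Q]

theorem contMDiffAt_extChartAt_symm (x : M) {y : E} (hy : y ∈ (extChartAt I x).target) :
    ContMDiffAt 𝓘(ℝ, E) I ∞ (extChartAt I x).symm y :=
  (contMDiffOn_extChartAt_symm x).contMDiffAt ((isOpen_extChartAt_target x).mem_nhds hy)

theorem mfderiv_extChartAt_symm_self_apply (x : M) (v : E) :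
    mfderiv 𝓘(ℝ, E) I (extChartAt I x).symm (extChartAt I x x) v = v := by
  have : IsManifold I 1 M := IsManifold.of_le (n := ∞) (by simp)
  have := mfderivWithin_range_extChartAt_symm (I := I) (x := x)
  rw [I.range_eq_univ, mfderivWithin_univ] at this
  exact DFunLike.congr_fun this v

/-- At its base point the preferred chart has the identity as derivative, by the definition of
`TangentSpace`. -/
theorem metricInChart_self_apply [FiniteDimensional ℝ E] (g : RMetric I M) (x : M) (v w : E) :
    metricInChart g x (extChartAt I x x) v w = g.inner x v w := by
  have h : ∀ z, z = x → ∀ v w : E, g.inner z v w = g.inner x v w := by rintro z rfl v w; rfl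
  rw [metricInChart_apply, mfderiv_extChartAt_symm_self_apply,
    mfderiv_extChartAt_symm_self_apply]
  exact h _ (extChartAt_to_inv x) v w

/-- The metric coefficients are smooth: the coordinate vector fields are smooth maps into
the tangent bundle, being values of the tangent map of the inverse chart. -/
theorem contDiffOn_metricInChart [FiniteDimensional ℝ E] (g : RMetric I M) (x : M) :
    ContDiffOn ℝ ∞ (metricInChart g x) (extChartAt I x).target := by
  refine contDiffOn_clm_apply.2 fun v ↦ contDiffOn_clm_apply.2 fun w y hy ↦ ?_
  refine ContDiffAt.contDiffWithinAt (ContMDiffAt.contDiffAt ?_)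
  have : IsManifold I 1 M := IsManifold.of_le (n := ∞) (by simp)
  have hopen := isOpen_extChartAt_target (I := I) x
  have hnhds := hopen.mem_nhds hy
  have hf := contMDiffAt_extChartAt_symm (I := I) x hy
  have htan : ∀ u : E, ContMDiffAt 𝓘(ℝ, E) I.tangent ∞
      (fun y ↦ (⟨(extChartAt I x).symm y, mfderiv 𝓘(ℝ, E) I (extChartAt I x).symm y u⟩ :
        TangentBundle I M)) y := by
    intro u
    have h1 := (contMDiffOn_extChartAt_symm (I := I) (n := ∞) x).contMDiffOn_tangentMapWithin
      (m := ∞) (by simp) hopen.uniqueMDiffOn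
    have h2 : ContMDiff 𝓘(ℝ, E) 𝓘(ℝ, E).tangent ∞
        (fun y ↦ (⟨y, u⟩ : TangentBundle 𝓘(ℝ, E) E)) :=
      contMDiff_vectorSpace_iff_contDiff.2 contDiff_const
    have h3 := (h1.comp h2.contMDiffOn (s := (extChartAt I x).target) fun y hy ↦ hy).contMDiffAt
      hnhds
    refine h3.congr_of_eventuallyEq ?_
    filter_upwards [hnhds] with z hz
    simp only [Function.comp, tangentMapWithin]
    rw [mfderivWithin_of_isOpen hopen hz]
  have hg := (g.contMDiff ((extChartAt I x).symm y)).comp y hf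
  have := ContMDiffAt.clm_bundle_apply₂ (F₁ := E) (F₂ := E) (F₃ := ℝ)
    (E₁ := fun x : M ↦ TangentSpace I x) (E₂ := fun x : M ↦ TangentSpace I x)
    (E₃ := Bundle.Trivial M ℝ) (b := (extChartAt I x).symm)
    (ψ := fun y ↦ g.inner ((extChartAt I x).symm y))
    (v := fun y ↦ mfderiv 𝓘(ℝ, E) I (extChartAt I x).symm y v)
    (w := fun y ↦ mfderiv 𝓘(ℝ, E) I (extChartAt I x).symm y w) hg (htan v) (htan w)
  rw [contMDiffAt_totalSpace] at this
  exact this.2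

theorem differentiableAt_metricInChart [FiniteDimensional ℝ E] (g : RMetric I M) (x : M) :
    DifferentiableAt ℝ (metricInChart g x) (extChartAt I x x) :=
  ((contDiffOn_metricInChart g x).contDiffAt
    ((isOpen_extChartAt_target x).mem_nhds (mem_extChartAt_target x))).differentiableAt (by simp)

theorem lowerChristoffel_apply [FiniteDimensional ℝ E] (g : RMetric I M) (x : M) (v w z : E) :
    lowerChristoffel (metricInChart g x) (extChartAt I x x) v w z =
      (1 / 2 : ℝ) * (fderiv ℝ (fun y ↦ metricInChart g x y w z) (extChartAt I x x) v +
        fderiv ℝ (fun y ↦ metricInChart g x y v z) (extChartAt I x x) w -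
        fderiv ℝ (fun y ↦ metricInChart g x y v w) (extChartAt I x x) z) := by
  have h : ∀ a b c : E, fderiv ℝ (fun y ↦ metricInChart g x y a b) (extChartAt I x x) c =
      fderiv ℝ (metricInChart g x) (extChartAt I x x) c a b := by
    intro a b c
    have h1 := (differentiableAt_metricInChart g x).hasFDerivAt
    have h2 := (h1.clm_apply (hasFDerivAt_const a _)).clm_apply (hasFDerivAt_const b _)
    rw [h2.fderiv]
    simp
  rw [h, h, h]
  simp [lowerChristoffel]

section Hessian

variable [FiniteDimensional ℝ E] [FiniteDimensional ℝ F]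

/-- The Gauss formula for Hessians:
`Hess (P ∘ φ) (v, w) = Hess P (dφ v, dφ w) + dP (α (v, w))`. It holds for any `C²` map `φ`, since
the Christoffel symbols on both sides cancel. -/
theorem hessian_comp (g : RMetric I M) (h : RMetric J Q) {φ : M → Q} {P : Q → ℝ} {x : M}
    (hφ : ContMDiffAt I J 2 φ x) (hP : ContMDiffAt J 𝓘(ℝ, ℝ) 2 P (φ x)) (v w : TangentSpace I x) :
    hessian g (P ∘ φ) x v w =
      hessian h P (φ x) (mfderiv I J φ x v) (mfderiv I J φ x w) +
        differential J P (φ x) (secondFundamentalForm g h φ x v w) := by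
  set Φ := writtenInExtChartAt I J x φ with hΦ
  set p := P ∘ (extChartAt J (φ x)).symm with hp
  set a := extChartAt I x x with ha
  have hΦa : Φ a = extChartAt J (φ x) (φ x) := by simp [hΦ, ha, writtenInExtChartAt]
  have hΦd : ContDiffAt ℝ 2 Φ a := contDiffAt_writtenInExtChartAt hφ
  have hpd : ContDiffAt ℝ 2 p (Φ a) := by
    rw [hΦa]; exact contDiffAt_comp_extChartAt_symm hP
  have hev : (P ∘ φ) ∘ (extChartAt I x).symm =ᶠ[𝓝 a] p ∘ Φ := by
    have hc : ContinuousAt (φ ∘ (extChartAt I x).symm) a := by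
      refine ContinuousAt.comp ?_ (continuousAt_extChartAt_symm x)
      simpa [ha] using hφ.continuousAt
    have hmem : (extChartAt J (φ x)).source ∈ 𝓝 ((φ ∘ (extChartAt I x).symm) a) := by
      simpa [ha] using extChartAt_source_mem_nhds (I := J) (φ x)
    filter_upwards [hc hmem] with y hy
    exact congrArg P ((extChartAt J (φ x)).left_inv hy).symm
  have hφm : MDifferentiableAt I J φ x := hφ.mdifferentiableAt two_ne_zero
  have hPm : MDifferentiableAt J 𝓘(ℝ, ℝ) P (φ x) := hP.mdifferentiableAt two_ne_zero
  have hD (v w : E) : fderiv ℝ (fderiv ℝ ((P ∘ φ) ∘ (extChartAt I x).symm)) a v w =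
      fderiv ℝ (fderiv ℝ p) (extChartAt J (φ x) (φ x)) (fderiv ℝ Φ a v) (fderiv ℝ Φ a w) +
        fderiv ℝ p (extChartAt J (φ x) (φ x)) (fderiv ℝ (fderiv ℝ Φ) a v w) := by
    rw [hev.fderiv.fderiv_eq, fderiv_fderiv_comp_apply hpd hΦd, hΦa]
  have hmap (T : TangentSpace J (φ x) →L[ℝ] ℝ) (a b c : TangentSpace J (φ x)) :
      T (a + b - c) = T a + T b - T c := by rw [map_sub, map_add]
  have hα : differential J P (φ x) (secondFundamentalForm g h φ x v w) =
      fderiv ℝ p (extChartAt J (φ x) (φ x)) (fderiv ℝ (fderiv ℝ Φ) a v w) +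
        differential J P (φ x)
          (christoffel h (φ x) (mfderiv I J φ x v) (mfderiv I J φ x w)) -
        differential J P (φ x) (mfderiv I J φ x (christoffel g x v w)) := by
    rw [← differential_eq_fderiv hPm]
    exact hmap _ _ _ _
  rw [hα, hessian_eq, hessian_eq, differential_comp hPm hφm, mfderiv_apply_eq_fderiv hφm v,
    mfderiv_apply_eq_fderiv hφm w]
  have := hD v w
  linarith

end Hessian

end Charts

/-! ### The Hessian of a lifted function on a warped product -/

section WarpedProduct

variable {E : Type*} [NormedAddCommGroup E] [NormedSpace ℝ E] [FiniteDimensional ℝ E]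
  {H : Type*} [TopologicalSpace H] {I : ModelWithCorners ℝ E H} [I.Boundaryless]
  {L : Type*} [TopologicalSpace L] [ChartedSpace H L] [IsManifold I ∞ L]
  {F : Type*} [NormedAddCommGroup F] [NormedSpace ℝ F] [FiniteDimensional ℝ F]
  {K : Type*} [TopologicalSpace K] {J : ModelWithCorners ℝ F K} [J.Boundaryless]
  {N : Type*} [TopologicalSpace N] [ChartedSpace K N] [IsManifold J ∞ N]

/-- The chart of a product is the product of the charts, so the coefficients of the warped metric
are block diagonal. -/
theorem metricInChart_warpedMetric (gL : RMetric I L) (gN : RMetric J N) (ξ : L → ℝ)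
    (hξ : ContMDiff I 𝓘(ℝ, ℝ) ∞ ξ) (hpos : ∀ y, 0 < ξ y) (p : L × N) {q : E × F}
    (hq : q ∈ (extChartAt (I.prod J) p).target) (X Y : E × F) :
    metricInChart (warpedMetric gL gN ξ hξ hpos) p q X Y =
      metricInChart gL p.1 q.1 X.1 Y.1 +
        ξ ((extChartAt I p.1).symm q.1) ^ 2 * metricInChart gN p.2 q.2 X.2 Y.2 := by
  have hq' : q.1 ∈ (extChartAt I p.1).target ∧ q.2 ∈ (extChartAt J p.2).target := by
    rw [extChartAt_prod] at hq; exact hq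
  have hs : MDifferentiableAt 𝓘(ℝ, E × F) (I.prod J) (extChartAt (I.prod J) p).symm q :=
    (contMDiffAt_extChartAt_symm p hq).mdifferentiableAt (by simp)
  have hsL : MDifferentiableAt 𝓘(ℝ, E) I (extChartAt I p.1).symm q.1 :=
    (contMDiffAt_extChartAt_symm p.1 hq'.1).mdifferentiableAt (by simp)
  have hsN : MDifferentiableAt 𝓘(ℝ, F) J (extChartAt J p.2).symm q.2 :=
    (contMDiffAt_extChartAt_symm p.2 hq'.2).mdifferentiableAt (by simp)
  have hd1 : MDifferentiableAt 𝓘(ℝ, E × F) 𝓘(ℝ, E) Prod.fst q :=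
    mdifferentiableAt_iff_differentiableAt.2 differentiableAt_fst
  have hd2 : MDifferentiableAt 𝓘(ℝ, E × F) 𝓘(ℝ, F) Prod.snd q :=
    mdifferentiableAt_iff_differentiableAt.2 differentiableAt_snd
  have h1 : ∀ Z : E × F, mfderiv (I.prod J) I Prod.fst ((extChartAt (I.prod J) p).symm q)
      (mfderiv 𝓘(ℝ, E × F) (I.prod J) (extChartAt (I.prod J) p).symm q Z) =
        mfderiv 𝓘(ℝ, E) I (extChartAt I p.1).symm q.1 Z.1 := by
    intro Z
    have a := DFunLike.congr_fun (mfderiv_comp (I' := I.prod J) q mdifferentiableAt_fst hs) Z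
    have b := DFunLike.congr_fun (mfderiv_comp (I' := 𝓘(ℝ, E)) q hsL hd1) Z
    rw [mfderiv_eq_fderiv (f := Prod.fst), fderiv_fst] at b
    exact a.symm.trans b
  have h2 : ∀ Z : E × F, mfderiv (I.prod J) J Prod.snd ((extChartAt (I.prod J) p).symm q)
      (mfderiv 𝓘(ℝ, E × F) (I.prod J) (extChartAt (I.prod J) p).symm q Z) =
        mfderiv 𝓘(ℝ, F) J (extChartAt J p.2).symm q.2 Z.2 := by
    intro Z
    have a := DFunLike.congr_fun (mfderiv_comp (I' := I.prod J) q mdifferentiableAt_snd hs) Z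
    have b := DFunLike.congr_fun (mfderiv_comp (I' := 𝓘(ℝ, F)) q hsN hd2) Z
    rw [mfderiv_eq_fderiv (f := Prod.snd), fderiv_snd] at b
    exact a.symm.trans b
  rw [metricInChart_apply, metricInChart_apply, metricInChart_apply, ← h1, ← h1, ← h2, ← h2]
  rfl

/-- The Hessian of a function lifted from the base of a warped product: for `X = (v, w)`,
`Hess (f ∘ π_L) (X, X) = Hess f (v, v) + ⟨∇ log ξ, ∇ f⟩ ξ² |w|²`. The derivative of `f ∘ π_L` on the
Christoffel symbol of the product is the inner product of that symbol with the horizontal vector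
`(∇ f, 0)`, so only derivatives of the metric coefficients enter. -/
theorem hessian_warpedMetric_comp_fst (gL : RMetric I L) (gN : RMetric J N) {ξ : L → ℝ}
    (hξ : ContMDiff I 𝓘(ℝ, ℝ) ∞ ξ) (hpos : ∀ y, 0 < ξ y) {f : L → ℝ} (p : L × N)
    (hf : ContMDiffAt I 𝓘(ℝ, ℝ) 2 f p.1) (X : TangentSpace (I.prod J) p) :
    hessian (warpedMetric gL gN ξ hξ hpos) (f ∘ Prod.fst) p X X =
      hessian gL f p.1 (mfderiv (I.prod J) I Prod.fst p X) (mfderiv (I.prod J) I Prod.fst p X) +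
        differential I (fun z ↦ Real.log (ξ z)) p.1 (gradient gL f p.1) *
          (ξ p.1 ^ 2 * gN.inner p.2 (mfderiv (I.prod J) J Prod.snd p X)
            (mfderiv (I.prod J) J Prod.snd p X)) := by
  obtain ⟨v, w⟩ : E × F := X
  set h := warpedMetric gL gN ξ hξ hpos with hh
  set ζ : E := gradient gL f p.1 with hζ
  set a := extChartAt I p.1 p.1 with ha
  set b := extChartAt J p.2 p.2 with hb
  have hcenter : extChartAt (I.prod J) p p = (a, b) := by rw [extChartAt_prod]; rfl
  have hX1 : mfderiv (I.prod J) I Prod.fst p ((v, w) : E × F) = v := by rw [mfderiv_fst]; rfl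
  have hX2 : mfderiv (I.prod J) J Prod.snd p ((v, w) : E × F) = w := by rw [mfderiv_snd]; rfl
  have hfm : MDifferentiableAt I 𝓘(ℝ, ℝ) f p.1 := hf.mdifferentiableAt two_ne_zero
  -- the second derivative in coordinates
  have hD : fderiv ℝ (fderiv ℝ ((f ∘ Prod.fst) ∘ (extChartAt (I.prod J) p).symm))
      (extChartAt (I.prod J) p p) ((v, w) : E × F) ((v, w) : E × F) =
        fderiv ℝ (fderiv ℝ (f ∘ (extChartAt I p.1).symm)) a v v := by
    have h1 : (f ∘ Prod.fst) ∘ (extChartAt (I.prod J) p).symm =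
        (f ∘ (extChartAt I p.1).symm) ∘ (Prod.fst : E × F → E) := by
      rw [extChartAt_prod]; rfl
    have h2 : ContDiffAt ℝ 2 (f ∘ (extChartAt I p.1).symm) (Prod.fst (a, b)) :=
      contDiffAt_comp_extChartAt_symm hf
    have h3 : fderiv ℝ (Prod.fst : E × F → E) = fun _ ↦ ContinuousLinearMap.fst ℝ E F :=
      funext fun _ ↦ fderiv_fst
    rw [h1, hcenter, fderiv_fderiv_comp_apply h2 contDiffAt_fst, h3]
    simp
  -- the first derivative applied to the Christoffel symbol
  have hΓ : differential (I.prod J) (f ∘ Prod.fst) p (christoffel h p ((v, w) : E × F)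
      ((v, w) : E × F)) = lowerChristoffel (metricInChart h p) (extChartAt (I.prod J) p p)
        ((v, w) : E × F) ((v, w) : E × F) ((ζ, 0) : E × F) := by
    rw [differential_comp hfm mdifferentiableAt_fst, ← inner_gradient gL]
    have h1 : ∀ Y : TangentSpace (I.prod J) p, h.inner p ((ζ, 0) : E × F) Y =
        gL.inner p.1 ζ (mfderiv (I.prod J) I Prod.fst p Y) := by
      intro Y
      have := warpedInner_apply gL gN ξ p ((ζ, 0) : E × F) Y
      rw [mfderiv_fst, mfderiv_snd] at this
      have h0 : gN.inner p.2 (0 : F) ((Y : E × F).2) = 0 := by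
        have := map_zero (gN.inner p.2)
        exact DFunLike.congr_fun this _
      rw [mfderiv_fst]
      refine this.trans ?_
      refine (congrArg _ (congrArg _ h0)).trans ?_
      rw [mul_zero, add_zero]
      rfl
    rw [← h1]
    exact (h.symm p _ _).trans (inner_sharp h p _ _)
  have hΓL : differential I f p.1 (christoffel gL p.1 v v) =
      lowerChristoffel (metricInChart gL p.1) a v v ζ := by
    rw [← inner_gradient gL]
    exact (gL.symm p.1 _ _).trans (inner_sharp gL p.1 _ _)
  have htarget : (extChartAt (I.prod J) p).target ∈ 𝓝 ((a, b) : E × F) := by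
    rw [← hcenter]
    exact (isOpen_extChartAt_target p).mem_nhds (mem_extChartAt_target p)
  have hdL : ∀ u u' : E, DifferentiableAt ℝ (fun y ↦ metricInChart gL p.1 y u u') a := fun u u' ↦
    ((differentiableAt_metricInChart gL p.1).clm_apply (differentiableAt_const u)).clm_apply
      (differentiableAt_const u')
  have hdN : DifferentiableAt ℝ (fun z ↦ metricInChart gN p.2 z w w) b :=
    ((differentiableAt_metricInChart gN p.2).clm_apply (differentiableAt_const w)).clm_apply
      (differentiableAt_const w)
  -- only the base block of the metric pairs with the horizontal vector `(ζ, 0)`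
  have hmix : fderiv ℝ (fun q ↦ metricInChart h p q ((v, w) : E × F) ((ζ, 0) : E × F))
      ((a, b) : E × F) (v, w) = fderiv ℝ (fun y ↦ metricInChart gL p.1 y v ζ) a v := by
    have hev : (fun q ↦ metricInChart h p q ((v, w) : E × F) ((ζ, 0) : E × F)) =ᶠ[𝓝 (a, b)]
        (fun y ↦ metricInChart gL p.1 y v ζ) ∘ Prod.fst := by
      filter_upwards [htarget] with q hq
      rw [hh, metricInChart_warpedMetric gL gN ξ hξ hpos p hq]
      simp
    rw [hev.fderiv_eq, fderiv_comp ((a, b) : E × F) (hdL v ζ) differentiableAt_fst, fderiv_fst]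
    simp
  -- in the horizontal direction `(ζ, 0)` the fibre block changes only through `ξ²`
  have hξm : MDifferentiableAt I 𝓘(ℝ, ℝ) ξ p.1 := (hξ p.1).mdifferentiableAt (by simp)
  have hξd : DifferentiableAt ℝ (ξ ∘ (extChartAt I p.1).symm) a :=
    (contDiffAt_comp_extChartAt_symm
      ((hξ p.1).of_le (m := 2) ENat.LEInfty.out)).differentiableAt two_ne_zero
  have hdiag : fderiv ℝ (fun q ↦ metricInChart h p q ((v, w) : E × F) ((v, w) : E × F))
      ((a, b) : E × F) (ζ, 0) = fderiv ℝ (fun y ↦ metricInChart gL p.1 y v v) a ζ +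
        2 * ξ p.1 * differential I ξ p.1 ζ * gN.inner p.2 w w := by
    have hev : (fun q ↦ metricInChart h p q ((v, w) : E × F) ((v, w) : E × F)) =ᶠ[𝓝 (a, b)]
        fun q ↦ metricInChart gL p.1 q.1 v v +
          (ξ ∘ (extChartAt I p.1).symm) q.1 ^ 2 * metricInChart gN p.2 q.2 w w := by
      filter_upwards [htarget] with q hq
      exact metricInChart_warpedMetric gL gN ξ hξ hpos p hq _ _
    have hfst : HasFDerivAt (Prod.fst : E × F → E) (.fst ℝ E F) ((a, b) : E × F) :=
      hasFDerivAt_fst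
    have hsnd : HasFDerivAt (Prod.snd : E × F → F) (.snd ℝ E F) ((a, b) : E × F) :=
      hasFDerivAt_snd
    have h1 := (hdL v v).hasFDerivAt.comp ((a, b) : E × F) hfst
    have h2 := hξd.hasFDerivAt.comp ((a, b) : E × F) hfst
    have h3 := hdN.hasFDerivAt.comp ((a, b) : E × F) hsnd
    have h4 := h1.add ((h2.pow 2).mul h3)
    rw [hev.fderiv_eq]
    refine (DFunLike.congr_fun (HasFDerivAt.fderiv h4) _).trans ?_
    have hξa : ξ ((extChartAt I p.1).symm a) = ξ p.1 := congrArg ξ (extChartAt_to_inv p.1)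
    have hdξ : differential I ξ p.1 ζ = fderiv ℝ (ξ ∘ (extChartAt I p.1).symm) a ζ :=
      DFunLike.congr_fun (differential_eq_fderiv hξm) ζ
    have hgN : gN.inner p.2 w w = metricInChart gN p.2 b w w :=
      (metricInChart_self_apply gN p.2 w w).symm
    rw [hdξ, hgN, ← hξa]
    clear_value a b
    simp
    ring
  have hhess : hessian h (f ∘ Prod.fst) p ((v, w) : E × F) ((v, w) : E × F) =
      fderiv ℝ (fderiv ℝ (f ∘ (extChartAt I p.1).symm)) a v v -
        lowerChristoffel (metricInChart h p) (extChartAt (I.prod J) p p)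
          ((v, w) : E × F) ((v, w) : E × F) ((ζ, 0) : E × F) :=
    (hessian_eq h _ p _ _).trans (congrArg₂ (· - ·) hD hΓ)
  have hhessL : hessian gL f p.1 v v = fderiv ℝ (fderiv ℝ (f ∘ (extChartAt I p.1).symm)) a v v -
      lowerChristoffel (metricInChart gL p.1) a v v ζ :=
    (hessian_eq gL f p.1 v v).trans (congrArg₂ (· - ·) rfl hΓL)
  rw [lowerChristoffel_apply, hcenter, hmix, hdiag] at hhess
  rw [lowerChristoffel_apply] at hhessL
  have hlog : differential I (fun z ↦ Real.log (ξ z)) p.1 ζ = (ξ p.1)⁻¹ * differential I ξ p.1 ζ :=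
    differential_log hξ hpos p.1 ζ
  rw [hX1, hX2, hlog]
  refine hhess.trans ?_
  rw [hhessL]
  have := hpos p.1
  field_simp
  ring

end WarpedProduct

/-! ### The Omori-Yau maximum principle for a pair -/

section MaximumPrinciple

variable {E : Type*} [NormedAddCommGroup E] [NormedSpace ℝ E]
  {H : Type*} [TopologicalSpace H] {I : ModelWithCorners ℝ E H}
  {W : Type*} [TopologicalSpace W] [ChartedSpace H W] [IsManifold I ∞ W]

theorem inner_self_nonneg (g : RMetric I W) (x : W) (v : TangentSpace I x) :
    0 ≤ g.inner x v v := by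
  by_cases h : v = 0
  · simp [h]
  · exact (g.pos x v h).le

theorem vnorm_nonneg (g : RMetric I W) (x : W) (v : TangentSpace I x) : 0 ≤ vnorm g x v :=
  Real.sqrt_nonneg _

theorem vnorm_sq (g : RMetric I W) (x : W) (v : TangentSpace I x) :
    vnorm g x v ^ 2 = g.inner x v v :=
  Real.sq_sqrt (inner_self_nonneg g x v)

theorem vnorm_smul (g : RMetric I W) (x : W) (c : ℝ) (v : TangentSpace I x) :
    vnorm g x (c • v) = |c| * vnorm g x v := by
  have h : g.inner x (c • v) (c • v) = c * c * g.inner x v v := by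
    simp only [map_smul, smul_apply, smul_eq_mul, mul_assoc]
  rw [vnorm, vnorm, h, Real.sqrt_mul (mul_self_nonneg c), Real.sqrt_mul_self_eq_abs]

theorem inner_le_vnorm_mul_vnorm (g : RMetric I W) (x : W) (v w : TangentSpace I x) :
    g.inner x v w ≤ vnorm g x v * vnorm g x w := by
  have h := LinearMap.BilinForm.apply_sq_le_of_symm (metricForm g x) (inner_self_nonneg g x)
    ⟨fun v w ↦ g.symm x v w⟩ v w
  have h' : g.inner x v w ^ 2 ≤ g.inner x v v * g.inner x w w := h
  rw [vnorm, vnorm, ← Real.sqrt_mul (inner_self_nonneg g x v)]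
  exact Real.le_sqrt_of_sq_le h'

variable [FiniteDimensional ℝ E]

theorem gradient_eq_smul (g : RMetric I W) {u f : W → ℝ} {x : W} {c : ℝ}
    (h : differential I u x = c • differential I f x) :
    gradient g u x = c • gradient g f x := by
  have h0 : ∀ w, g.inner x (gradient g u x - c • gradient g f x) w = 0 := fun w ↦ by
    rw [map_sub, map_smul, sub_apply, smul_apply, inner_gradient, inner_gradient, h, smul_apply,
      sub_self]
  by_contra hne
  have := g.pos x _ (sub_ne_zero.2 hne)
  rw [h0] at this
  exact lt_irrefl _ this

variable [I.Boundaryless]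

theorem differential_hessian_of_isLocalMax_sub (g : RMetric I W) {u f : W → ℝ} {x : W}
    (hu : ContMDiffAt I 𝓘(ℝ, ℝ) 2 u x) (hf : ContMDiffAt I 𝓘(ℝ, ℝ) 2 f x) (c : ℝ)
    (hmax : IsLocalMax (fun y ↦ u y - c * f y) x) :
    differential I u x = c • differential I f x ∧
      ∀ v : TangentSpace I x, hessian g u x v v ≤ c * hessian g f x v v := by
  set a := extChartAt I x x with ha
  set U := u ∘ (extChartAt I x).symm with hU
  set F := f ∘ (extChartAt I x).symm with hF
  have hUd : ContDiffAt ℝ 2 U a := contDiffAt_comp_extChartAt_symm hu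
  have hFd : ContDiffAt ℝ 2 F a := contDiffAt_comp_extChartAt_symm hf
  have hmax' : IsLocalMax (U - c • F) a := by
    have h : IsLocalMax (fun y ↦ u y - c * f y) ((extChartAt I x).symm a) := by
      rwa [extChartAt_to_inv]
    exact h.comp_continuous (continuousAt_extChartAt_symm x)
  have hev : fderiv ℝ (U - c • F) =ᶠ[𝓝 a] fun y ↦ fderiv ℝ U y - c • fderiv ℝ F y := by
    filter_upwards [hUd.eventually (by simp), hFd.eventually (by simp)] with y h1 h2
    rw [fderiv_sub (h1.differentiableAt two_ne_zero)
      ((h2.differentiableAt two_ne_zero).const_smul c),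
      fderiv_const_smul (h2.differentiableAt two_ne_zero)]
  have hd : fderiv ℝ U a - c • fderiv ℝ F a = 0 := hev.eq_of_nhds ▸ hmax'.fderiv_eq_zero
  have hdU : DifferentiableAt ℝ (fderiv ℝ U) a :=
    (hUd.fderiv_right (m := 1) le_rfl).differentiableAt one_ne_zero
  have hdF : DifferentiableAt ℝ (fderiv ℝ F) a :=
    (hFd.fderiv_right (m := 1) le_rfl).differentiableAt one_ne_zero
  have hdd (v : E) : fderiv ℝ (fderiv ℝ U) a v v - c * fderiv ℝ (fderiv ℝ F) a v v ≤ 0 := by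
    have h1 : fderiv ℝ (fderiv ℝ (U - c • F)) a v v ≤ 0 :=
      fderiv_fderiv_apply_le_of_isLocalMax (hUd.sub (hFd.const_smul c)) hmax' v
    have h2 : fderiv ℝ (fun y ↦ fderiv ℝ U y - c • fderiv ℝ F y) a =
        fderiv ℝ (fderiv ℝ U) a - c • fderiv ℝ (fderiv ℝ F) a :=
      (hdU.hasFDerivAt.sub (hdF.hasFDerivAt.const_smul c)).fderiv
    rw [hev.fderiv_eq, h2] at h1
    exact h1
  have hdiff : differential I u x = c • differential I f x := by
    rw [differential_eq_fderiv (hu.mdifferentiableAt two_ne_zero),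
      differential_eq_fderiv (hf.mdifferentiableAt two_ne_zero)]
    exact sub_eq_zero.1 hd
  refine ⟨hdiff, fun v ↦ ?_⟩
  have h3 := hdd v
  have h4 : differential I u x (christoffel g x v v) =
      c * differential I f x (christoffel g x v v) := by rw [hdiff]; rfl
  rw [hessian_eq, hessian_eq, h4]
  have : ∀ A B D : ℝ, A - c * B ≤ 0 → A - c * D ≤ c * (B - D) := fun A B D h ↦ by linarith
  exact this _ _ _ h3

theorem vnorm_gradient_laplacian_of_isLocalMax_sub (g : RMetric I W) {u f : W → ℝ} {x : W}
    (hu : ContMDiffAt I 𝓘(ℝ, ℝ) 2 u x) (hf : ContMDiffAt I 𝓘(ℝ, ℝ) 2 f x) {c : ℝ} (hc : 0 ≤ c)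
    (hmax : IsLocalMax (fun y ↦ u y - c * f y) x) :
    vnorm g x (gradient g u x) = c * vnorm g x (gradient g f x) ∧
      laplacian g u x ≤ c * laplacian g f x := by
  obtain ⟨h1, h2⟩ := differential_hessian_of_isLocalMax_sub g hu hf c hmax
  refine ⟨by rw [gradient_eq_smul g h1, vnorm_smul, abs_of_nonneg hc], ?_⟩
  rw [laplacian, laplacian, Finset.mul_sum]
  exact Finset.sum_le_sum fun i _ ↦ h2 _

/-- Let `I = ∫₀ ds / √G + 1`. If `u` does not attain its supremum `s`, its supremum over the
exceptional compact set is smaller than `s`, and for small `ε > 0` the function `u - ε log I(γ)`,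
which has a maximum, takes it off that set. There the tangent line of the concave function `log I`
replaces `log I(γ)` by a multiple of `γ`, to which the two bounds of the pair apply. -/
theorem IsOmoriYauPairLaplacian.exists_almost_max [Nonempty W] {g : RMetric I W} {G : ℝ → ℝ}
    {γ : W → ℝ} (h : IsOmoriYauPairLaplacian g G γ) {u : W → ℝ}
    (hu : ContMDiff I 𝓘(ℝ, ℝ) 2 u) (hbdd : BddAbove (range u)) {δ : ℝ} (hδ : 0 < δ) :
    ∃ x, (⨆ y, u y) - δ < u x ∧ vnorm g x (gradient g u x) < δ ∧ laplacian g u x < δ := by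
  have hle : ∀ y, u y ≤ ⨆ y, u y := fun y ↦ le_ciSup hbdd y
  set s := ⨆ y, u y with hs
  by_cases hatt : ∃ x, u x = s
  · obtain ⟨x, hx⟩ := hatt
    -- a maximum of `u` itself: the multiple of `γ` is zero
    have hmax : IsLocalMax (fun y ↦ u y - 0 * γ y) x :=
      Eventually.of_forall fun y ↦ by simpa [hx] using hle y
    obtain ⟨h1, h2⟩ := vnorm_gradient_laplacian_of_isLocalMax_sub g (hu x) (h.γ_contMDiff x)
      le_rfl hmax
    exact ⟨x, by linarith, by linarith, by linarith⟩
  have hlt : ∀ y, u y < s := fun y ↦ (hle y).lt_of_ne fun e ↦ hatt ⟨y, e⟩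
  obtain ⟨A, hA, C₁, hC₁, hgrad⟩ := h.grad_le
  obtain ⟨B, hB, C₂, hC₂, hlap⟩ := h.laplacian_le
  obtain ⟨J, hJ, hJeq, -⟩ := exists_contDiff_eq_recipSqrtIntegral h.G_contDiffOn h.G_pos
  let ℓ : W → ℝ := fun y ↦ Real.log (recipSqrtIntegral G (γ y) + 1)
  have hI : ∀ y, 1 ≤ recipSqrtIntegral G (γ y) + 1 := fun y ↦ by
    linarith [recipSqrtIntegral_nonneg (G := G) (h.γ_nonneg y)]
  have hℓ0 : ∀ y, 0 ≤ ℓ y := fun y ↦ Real.log_nonneg (hI y)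
  have hℓc : Continuous ℓ := by
    have h1 : Continuous fun y ↦ recipSqrtIntegral G (γ y) + 1 := by
      have : (fun y ↦ recipSqrtIntegral G (γ y) + 1) = fun y ↦ J (γ y) + 1 :=
        funext fun y ↦ by rw [hJeq _ (h.γ_nonneg y)]
      rw [this]
      exact (hJ.continuous.comp h.γ_contMDiff.continuous).add continuous_const
    exact h1.log fun y ↦ (zero_lt_one.trans_le (hI y)).ne'
  have hℓt : Tendsto ℓ (cocompact W) atTop :=
    Real.tendsto_log_atTop.comp
      ((tendsto_atTop_add_const_right _ 1 h.G_integral).comp h.γ_tendsto)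
  -- values above `s - η` are not taken on the exceptional compact set
  obtain ⟨η, hη, hηδ, hηC⟩ : ∃ η, 0 < η ∧ η ≤ δ ∧ ∀ y ∈ C₁ ∪ C₂, u y ≤ s - η := by
    rcases (C₁ ∪ C₂).eq_empty_or_nonempty with he | hne
    · exact ⟨δ, hδ, le_rfl, by simp [he]⟩
    · obtain ⟨z, -, hz⟩ := (hC₁.union hC₂).exists_isMaxOn hne hu.continuous.continuousOn
      refine ⟨min δ (s - u z), lt_min hδ (sub_pos.2 (hlt z)), min_le_left _ _, fun y hy ↦ ?_⟩
      have h1 : u y ≤ u z := hz hy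
      have h2 := min_le_right δ (s - u z)
      linarith
  obtain ⟨p, hp⟩ : ∃ p, s - η / 2 < u p := exists_lt_of_lt_ciSup (by linarith)
  obtain ⟨ε, hε, hεA, hεB, hεp⟩ : ∃ ε, 0 < ε ∧ ε * A < δ ∧ ε * B < δ ∧ ε * ℓ p ≤ η / 2 := by
    have hD : 0 < A + B + ℓ p + 1 := by linarith [hℓ0 p]
    have key : ∀ t, t ≤ A + B + ℓ p + 1 → η / 2 / (A + B + ℓ p + 1) * t ≤ η / 2 := fun t ht ↦ by
      rw [div_mul_eq_mul_div, div_le_iff₀ hD]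
      gcongr
    refine ⟨η / 2 / (A + B + ℓ p + 1), by positivity, ?_, ?_, ?_⟩
    · exact (key A (by linarith [hℓ0 p])).trans_lt (by linarith)
    · exact (key B (by linarith [hℓ0 p])).trans_lt (by linarith)
    · exact key _ (by linarith)
  -- the maximum exists, since `ℓ` tends to infinity and `u` is bounded above
  obtain ⟨x, hx⟩ : ∃ x, ∀ y, u y - ε * ℓ y ≤ u x - ε * ℓ x := by
    have hcont : Continuous fun y ↦ u y - ε * ℓ y :=
      hu.continuous.sub (continuous_const.mul hℓc)
    refine hcont.exists_forall_ge' p ?_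
    filter_upwards [hℓt.eventually_ge_atTop ((s - (u p - ε * ℓ p)) / ε)] with y hy
    rw [div_le_iff₀ hε] at hy
    linarith [hle y]
  have hux : s - η < u x := by
    have := hx p
    have := mul_nonneg hε.le (hℓ0 x)
    linarith
  have hxC : x ∉ C₁ ∪ C₂ := fun hmem ↦ by linarith [hηC x hmem]
  have hG : 0 < √(G (γ x)) * (recipSqrtIntegral G (γ x) + 1) :=
    mul_pos (Real.sqrt_pos.2 (h.G_pos _ (h.γ_nonneg x))) (zero_lt_one.trans_le (hI x))
  set q := √(G (γ x)) * (recipSqrtIntegral G (γ x) + 1) with hq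
  -- by concavity of `log I`, the function `u - (ε / q) γ` is also maximal at `x`
  have hmax : IsLocalMax (fun y ↦ u y - ε * q⁻¹ * γ y) x := by
    refine Eventually.of_forall fun y ↦ ?_
    have h1 := hx y
    have h2 : ℓ y ≤ ℓ x + q⁻¹ * (γ y - γ x) := log_recipSqrtIntegral_le h.G_contDiffOn h.G_pos
      h.G_deriv_nonneg (h.γ_nonneg y) (h.γ_nonneg x)
    have h3 := mul_le_mul_of_nonneg_left h2 hε.le
    simp only
    linarith
  have hc : 0 ≤ ε * q⁻¹ := by positivity
  obtain ⟨h1, h2⟩ := vnorm_gradient_laplacian_of_isLocalMax_sub g (hu x) (h.γ_contMDiff x) hc hmax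
  have hcancel : ∀ D, ε * q⁻¹ * (D * q) = ε * D := fun D ↦ by field_simp
  refine ⟨x, by linarith, ?_, ?_⟩
  · have := mul_le_mul_of_nonneg_left (hgrad x fun hm ↦ hxC (Or.inl hm)) hc
    rw [hcancel] at this
    linarith
  · have := mul_le_mul_of_nonneg_left (hlap x fun hm ↦ hxC (Or.inr hm)) hc
    rw [hcancel] at this
    linarith

theorem IsOmoriYauPairLaplacian.omoriYauPrinciple [Nonempty W] {g : RMetric I W} {G : ℝ → ℝ}
    {γ : W → ℝ} (h : IsOmoriYauPairLaplacian g G γ) : OmoriYauPrinciple g := by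
  intro u hu hbdd
  have hpos : ∀ k : ℕ, (0 : ℝ) < 1 / (k + 1) := fun k ↦ Nat.one_div_pos_of_nat
  choose x hx1 hx2 hx3 using fun k : ℕ ↦ h.exists_almost_max hu hbdd (hpos k)
  refine ⟨x, ?_, fun k hk ↦ ?_⟩
  · have h1 : Tendsto (fun k : ℕ ↦ (⨆ y, u y) - 1 / ((k : ℝ) + 1)) atTop (𝓝 (⨆ y, u y)) := by
      simpa using tendsto_const_nhds.sub (tendsto_one_div_add_atTop_nhds_zero_nat (𝕜 := ℝ))
    exact tendsto_of_tendsto_of_tendsto_of_le_of_le h1 tendsto_const_nhds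
      (fun k ↦ (hx1 k).le) fun k ↦ le_ciSup hbdd (x k)
  · have hk' : (0 : ℝ) < k := by exact_mod_cast hk
    have hle : 1 / ((k : ℝ) + 1) ≤ 1 / (k : ℝ) := one_div_le_one_div_of_le hk' (by linarith)
    exact ⟨(hx2 k).trans_le hle, (hx3 k).trans_le hle⟩

end MaximumPrinciple

/-! ### Isometric immersions into warped products -/

section Submanifold

variable {E : Type*} [NormedAddCommGroup E] [NormedSpace ℝ E] [FiniteDimensional ℝ E]
  {H : Type*} [TopologicalSpace H] {I : ModelWithCorners ℝ E H}
  {M : Type*} [TopologicalSpace M] [ChartedSpace H M] [IsManifold I ∞ M]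
  {E₁ : Type*} [NormedAddCommGroup E₁] [NormedSpace ℝ E₁] [FiniteDimensional ℝ E₁]
  {H₁ : Type*} [TopologicalSpace H₁] {I₁ : ModelWithCorners ℝ E₁ H₁}
  {L : Type*} [TopologicalSpace L] [ChartedSpace H₁ L] [IsManifold I₁ ∞ L]
  {E₂ : Type*} [NormedAddCommGroup E₂] [NormedSpace ℝ E₂] [FiniteDimensional ℝ E₂]
  {H₂ : Type*} [TopologicalSpace H₂] {I₂ : ModelWithCorners ℝ E₂ H₂}
  {N : Type*} [TopologicalSpace N] [ChartedSpace H₂ N] [IsManifold I₂ ∞ N]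
  {gM : RMetric I M} {gL : RMetric I₁ L} {gN : RMetric I₂ N}
  {ξ : L → ℝ} {hξ : ContMDiff I₁ 𝓘(ℝ, ℝ) ∞ ξ} {hpos : ∀ y, 0 < ξ y} {φ : M → L × N}

theorem vnorm_mfderiv_fst_le (p : L × N) (X : TangentSpace (I₁.prod I₂) p) :
    vnorm gL p.1 (mfderiv (I₁.prod I₂) I₁ Prod.fst p X) ≤
      vnorm (warpedMetric gL gN ξ hξ hpos) p X := by
  refine Real.sqrt_le_sqrt ?_
  have h1 := warpedInner_apply gL gN ξ p X X
  have h2 := mul_nonneg (sq_nonneg (ξ p.1))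
    (inner_self_nonneg gN p.2 (mfderiv (I₁.prod I₂) I₂ Prod.snd p X))
  have h3 : (warpedMetric gL gN ξ hξ hpos).inner p X X = warpedInner gL gN ξ p X X := rfl
  rw [h3, h1]
  linarith

theorem differential_comp_fst_le {γ : L → ℝ} {p : L × N}
    (hγ : MDifferentiableAt I₁ 𝓘(ℝ, ℝ) γ p.1) (X : TangentSpace (I₁.prod I₂) p) :
    differential (I₁.prod I₂) (γ ∘ Prod.fst) p X ≤
      vnorm gL p.1 (gradient gL γ p.1) * vnorm (warpedMetric gL gN ξ hξ hpos) p X := by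
  rw [differential_comp hγ mdifferentiableAt_fst, ← inner_gradient gL]
  exact (inner_le_vnorm_mul_vnorm gL _ _ _).trans
    (mul_le_mul_of_nonneg_left (vnorm_mfderiv_fst_le p X) (vnorm_nonneg _ _ _))

/-- The differentials of an isometric immersion and of `π_L` do not increase lengths. -/
theorem IsIsometricImmersion.vnorm_gradient_comp_fst_le
    (hφ : IsIsometricImmersion gM (warpedMetric gL gN ξ hξ hpos) φ) {γ : L → ℝ} {x : M}
    (hγ : MDifferentiableAt I₁ 𝓘(ℝ, ℝ) γ (φ x).1) :
    vnorm gM x (gradient gM (fun x ↦ γ (φ x).1) x) ≤ vnorm gL (φ x).1 (gradient gL γ (φ x).1) := by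
  set u := gradient gM (fun x ↦ γ (φ x).1) x with hu
  have hφm : MDifferentiableAt I (I₁.prod I₂) φ x := (hφ.contMDiff x).mdifferentiableAt (by simp)
  have hγ' : MDifferentiableAt (I₁.prod I₂) 𝓘(ℝ, ℝ) (γ ∘ Prod.fst) (φ x) :=
    MDifferentiableAt.comp (I' := I₁) (φ x) hγ mdifferentiableAt_fst
  have h1 : vnorm gM x u ^ 2 =
      differential (I₁.prod I₂) (γ ∘ Prod.fst) (φ x) (mfderiv I (I₁.prod I₂) φ x u) := by
    rw [vnorm_sq, ← differential_comp hγ' hφm]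
    exact inner_gradient gM _ x u
  have h2 : vnorm (warpedMetric gL gN ξ hξ hpos) (φ x) (mfderiv I (I₁.prod I₂) φ x u) =
      vnorm gM x u := congrArg Real.sqrt (hφ.isometric x u u)
  have h3 := differential_comp_fst_le (gL := gL) (gN := gN) (ξ := ξ) (hξ := hξ) (hpos := hpos) hγ
    (mfderiv I (I₁.prod I₂) φ x u)
  rw [h2, ← h1, sq] at h3
  rcases (vnorm_nonneg gM x u).eq_or_lt with h | h
  · rw [← h]; exact vnorm_nonneg _ _ _
  · exact le_of_mul_le_mul_right h3 h

variable [I.Boundaryless] [I₁.Boundaryless] [I₂.Boundaryless]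

/-- The trace of the Gauss formula, for a function lifted from the base. -/
theorem IsIsometricImmersion.laplacian_comp_fst
    (hφ : IsIsometricImmersion gM (warpedMetric gL gN ξ hξ hpos) φ) {γ : L → ℝ}
    (hγ : ContMDiff I₁ 𝓘(ℝ, ℝ) 2 γ) (x : M) :
    laplacian gM (fun x ↦ γ (φ x).1) x =
      ∑ i, hessian (warpedMetric gL gN ξ hξ hpos) (γ ∘ Prod.fst) (φ x)
          (mfderiv I (I₁.prod I₂) φ x (orthonormalFrame gM x i))
          (mfderiv I (I₁.prod I₂) φ x (orthonormalFrame gM x i)) +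
        differential (I₁.prod I₂) (γ ∘ Prod.fst) (φ x)
          (meanCurvature gM (warpedMetric gL gN ξ hξ hpos) φ x) := by
  have hγ' : ContMDiff (I₁.prod I₂) 𝓘(ℝ, ℝ) 2 (γ ∘ Prod.fst : L × N → ℝ) :=
    hγ.comp contMDiff_fst
  rw [meanCurvature, map_sum, ← Finset.sum_add_distrib]
  refine Finset.sum_congr rfl fun i _ ↦ ?_
  exact hessian_comp gM _ ((hφ.contMDiff x).of_le ENat.LEInfty.out) (hγ' (φ x)) _ _

/-- The image under `φ` of a unit vector has components `v`, `w` with `|v|² + ξ² |w|² = 1`, so each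
term of the trace is at most `b + a r`; the mean curvature contributes at most `a r`. -/
theorem IsIsometricImmersion.laplacian_comp_fst_le
    (hφ : IsIsometricImmersion gM (warpedMetric gL gN ξ hξ hpos) φ) {γ : L → ℝ}
    (hγ : ContMDiff I₁ 𝓘(ℝ, ℝ) 2 γ) {x : M} {a b r : ℝ} (hb : 0 ≤ b)
    (hgrad : vnorm gL (φ x).1 (gradient gL γ (φ x).1) ≤ a)
    (hhess : ∀ v : TangentSpace I₁ (φ x).1,
      hessian gL γ (φ x).1 v v ≤ b * gL.inner (φ x).1 v v)
    (hlog : vnorm gL (φ x).1 (gradient gL (fun z ↦ Real.log (ξ z)) (φ x).1) ≤ r)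
    (hH : vnorm (warpedMetric gL gN ξ hξ hpos) (φ x)
      (meanCurvature gM (warpedMetric gL gN ξ hξ hpos) φ x) ≤ r) :
    laplacian gM (fun x ↦ γ (φ x).1) x ≤ Module.finrank ℝ E * (b + a * r) + a * r := by
  have ha : 0 ≤ a := (vnorm_nonneg _ _ _).trans hgrad
  have hr : 0 ≤ r := (vnorm_nonneg _ _ _).trans hH
  have har : 0 ≤ a * r := mul_nonneg ha hr
  rw [hφ.laplacian_comp_fst hγ x]
  refine add_le_add ?_ ?_
  · have hterm : ∀ i ∈ (Finset.univ : Finset (Fin (Module.finrank ℝ E))),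
        hessian (warpedMetric gL gN ξ hξ hpos) (γ ∘ Prod.fst) (φ x)
          (mfderiv I (I₁.prod I₂) φ x (orthonormalFrame gM x i))
          (mfderiv I (I₁.prod I₂) φ x (orthonormalFrame gM x i)) ≤ b + a * r := by
      intro i _
      set X := mfderiv I (I₁.prod I₂) φ x (orthonormalFrame gM x i) with hX
      -- `dφ` maps a unit vector to a unit vector
      have hone : warpedInner gL gN ξ (φ x) X X = 1 :=
        (hφ.isometric x _ _).trans (by simp [inner_orthonormalFrame])
      rw [warpedInner_apply] at hone
      rw [hessian_warpedMetric_comp_fst gL gN hξ hpos (φ x) (hγ (φ x).1) X]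
      set v := mfderiv (I₁.prod I₂) I₁ Prod.fst (φ x) X
      set w := mfderiv (I₁.prod I₂) I₂ Prod.snd (φ x) X
      have hv := inner_self_nonneg gL (φ x).1 v
      have hw := mul_nonneg (sq_nonneg (ξ (φ x).1)) (inner_self_nonneg gN (φ x).2 w)
      refine add_le_add ((hhess v).trans ?_) ?_
      · exact mul_le_of_le_one_right hb (by linarith)
      · have h1 : differential I₁ (fun z ↦ Real.log (ξ z)) (φ x).1 (gradient gL γ (φ x).1) ≤
            a * r := by
          rw [← inner_gradient gL, mul_comm a r]
          exact (inner_le_vnorm_mul_vnorm gL _ _ _).trans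
            (mul_le_mul hlog hgrad (vnorm_nonneg _ _ _) hr)
        exact (mul_le_mul_of_nonneg_right h1 hw).trans
          (mul_le_of_le_one_right har (by linarith))
    refine (Finset.sum_le_sum hterm).trans ?_
    simp [mul_add]
  · refine (differential_comp_fst_le (gL := gL) (gN := gN) (ξ := ξ) (hξ := hξ) (hpos := hpos)
      ((hγ (φ x).1).mdifferentiableAt two_ne_zero) _).trans ?_
    exact mul_le_mul hgrad hH (vnorm_nonneg _ _ _) ha

/-- With `I = ∫₀ ds / √G + 1` the bound for the Laplacian is a multiple of `√G I (log I + 1)`, which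
is exactly `√G' I'` for `G' = logScale G` and its own `I' = log I + 1`. -/
theorem IsOmoriYauPairHessian.comp_isIsometricImmersion {G : ℝ → ℝ} {γ : L → ℝ}
    (hpair : IsOmoriYauPairHessian gL G γ)
    (hφ : IsIsometricImmersion gM (warpedMetric gL gN ξ hξ hpos) φ)
    (hproper : IsProperMap fun x ↦ (φ x).1)
    (hlog : ∀ y : L, vnorm gL y (gradient gL (fun z ↦ Real.log (ξ z)) y) ≤
      Real.log (recipSqrtIntegral G (γ y) + 1))
    (hH : ∀ x : M, vnorm (warpedMetric gL gN ξ hξ hpos) (φ x)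
        (meanCurvature gM (warpedMetric gL gN ξ hξ hpos) φ x) ≤
      Real.log (recipSqrtIntegral G (γ (φ x).1) + 1)) :
    IsOmoriYauPairLaplacian gM (logScale G) (fun x ↦ γ (φ x).1) := by
  obtain ⟨A, hA, C₁, hC₁, hgrad⟩ := hpair.grad_le
  obtain ⟨B, hB, C₂, hC₂, hhess⟩ := hpair.hessian_le
  have hq : ∀ y, 0 ≤ √(G (γ y)) * (recipSqrtIntegral G (γ y) + 1) := fun y ↦ by
    have := recipSqrtIntegral_nonneg (G := G) (hpair.γ_nonneg y)
    positivity
  have hr : ∀ y, 0 ≤ Real.log (recipSqrtIntegral G (γ y) + 1) := fun y ↦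
    (vnorm_nonneg _ _ _).trans (hlog y)
  have hscale : ∀ y, √(logScale G (γ y)) * (recipSqrtIntegral (logScale G) (γ y) + 1) =
      √(G (γ y)) * (recipSqrtIntegral G (γ y) + 1) *
        (Real.log (recipSqrtIntegral G (γ y) + 1) + 1) := fun y ↦ by
    rw [sqrt_logScale (hpair.γ_nonneg y),
      recipSqrtIntegral_logScale hpair.G_contDiffOn hpair.G_pos (hpair.γ_nonneg y)]
  refine ⟨⟨contDiffOn_logScale hpair.G_contDiffOn hpair.G_pos,
    fun t ht ↦ logScale_pos hpair.G_pos ht,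
    fun t ht ↦ derivWithin_logScale_nonneg hpair.G_contDiffOn hpair.G_pos hpair.G_deriv_nonneg ht,
    tendsto_recipSqrtIntegral_logScale hpair.G_contDiffOn hpair.G_pos hpair.G_integral,
    ?_, fun x ↦ hpair.γ_nonneg _, ?_, ?_⟩, ?_⟩
  · exact hpair.γ_contMDiff.comp
      ((contMDiff_fst.comp hφ.contMDiff).of_le ENat.LEInfty.out)
  · refine hpair.γ_tendsto.comp (hasBasis_cocompact.tendsto_right_iff.2 fun C hC ↦ ?_)
    exact (hproper.isCompact_preimage hC).compl_mem_cocompact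
  · refine ⟨A, hA, _, hproper.isCompact_preimage hC₁, fun x hx ↦ ?_⟩
    rw [hscale]
    refine (hφ.vnorm_gradient_comp_fst_le
      ((hpair.γ_contMDiff _).mdifferentiableAt two_ne_zero)).trans ((hgrad _ hx).trans ?_)
    exact mul_le_mul_of_nonneg_left
      (le_mul_of_one_le_right (hq _) (by linarith [hr (φ x).1])) hA.le
  · refine ⟨Module.finrank ℝ E * (B + A) + A, by positivity, _,
      hproper.isCompact_preimage (hC₁.union hC₂), fun x hx ↦ ?_⟩
    rw [hscale]
    refine (hφ.laplacian_comp_fst_le hpair.γ_contMDiff (mul_nonneg hB.le (hq (φ x).1))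
      (hgrad _ fun h ↦ hx (Or.inl h)) (hhess _ fun h ↦ hx (Or.inr h)) (hlog _) (hH x)).trans ?_
    have h1 := hq (φ x).1
    have h2 := hr (φ x).1
    set q := √(G (γ (φ x).1)) * (recipSqrtIntegral G (γ (φ x).1) + 1)
    set r := Real.log (recipSqrtIntegral G (γ (φ x).1) + 1)
    have e : (Module.finrank ℝ E * (B + A) + A) * (q * (r + 1)) -
        (Module.finrank ℝ E * (B * q + A * q * r) + A * q * r) =
          Module.finrank ℝ E * (B * (q * r) + A * q) + A * q := by ring
    have : 0 ≤ Module.finrank ℝ E * (B * (q * r) + A * q) + A * q := by positivity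
    linarith

end Submanifold

end OmoriYau

end

theorem lemma4p6 {m l n : ℕ}
    {M : Type*} [TopologicalSpace M] [T2Space M] [Nonempty M]
    [ChartedSpace (EuclideanSpace ℝ (Fin m)) M] [IsManifold (𝓡 m) ∞ M]
    {L : Type*} [TopologicalSpace L] [T2Space L]
    [ChartedSpace (EuclideanSpace ℝ (Fin l)) L] [IsManifold (𝓡 l) ∞ L]
    {N : Type*} [TopologicalSpace N] [T2Space N]
    [ChartedSpace (EuclideanSpace ℝ (Fin n)) N] [IsManifold (𝓡 n) ∞ N]
    (gM : OmoriYau.RMetric (𝓡 m) M) (gL : OmoriYau.RMetric (𝓡 l) L)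
    (gN : OmoriYau.RMetric (𝓡 n) N)
    (ξ : L → ℝ) (hξ : ContMDiff (𝓡 l) 𝓘(ℝ, ℝ) ∞ ξ) (hξpos : ∀ y, 0 < ξ y)
    (φ : M → L × N)
    (hφ : OmoriYau.IsIsometricImmersion gM (OmoriYau.warpedMetric gL gN ξ hξ hξpos) φ)
    (hproper : IsProperMap fun x ↦ (φ x).1)
    (G : ℝ → ℝ) (γ : L → ℝ) (hpair : OmoriYau.IsOmoriYauPairHessian gL G γ)
    (hgrad : ∀ y : L, OmoriYau.vnorm gL y (OmoriYau.gradient gL (fun z ↦ Real.log (ξ z)) y) ≤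
      Real.log (OmoriYau.recipSqrtIntegral G (γ y) + 1))
    (hH : ∀ x : M, OmoriYau.vnorm (OmoriYau.warpedMetric gL gN ξ hξ hξpos) (φ x)
        (OmoriYau.meanCurvature gM (OmoriYau.warpedMetric gL gN ξ hξ hξpos) φ x) ≤
      Real.log (OmoriYau.recipSqrtIntegral G (γ (φ x).1) + 1)) :
    (∃ G' : ℝ → ℝ, OmoriYau.IsOmoriYauPairLaplacian gM G' (fun x ↦ γ (φ x).1)) ∧
      OmoriYau.OmoriYauPrinciple gM := by
  have h := hpair.comp_isIsometricImmersion hφ hproper hgrad hH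
  exact ⟨⟨_, h⟩, h.omoriYauPrinciple⟩
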